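/- All graphs are finite and simple, and are considered up to isomorphism. A graph is $k$-critical if its chromatic number is $k$ and none of its proper induced subgraphs has chromatic number $k$. Let $P_5$ be the path on five vertices and $\overline{P}_5$ its complement, and let $\mathcal{C}_k$ be the set of $k$-critical graphs that contain neither $P_5$ nor $\overline{P}_5$ as an induced subgraph. Write $K_n$ for the clique on $n$ vertices and $C_5$ for the cycle on five vertices. The join of two graphs is their disjoint union together with all edges between them, and $\mathcal{A}\otimes\mathcal{B}$ is the set of joins of a member of $\mathcal{A}$ and a member of $\mathcal{B}$. The buoy $(B_1,\dots,B_5)$ is the graph obtained from $C_5$ by substituting the graph $B_i$ for its $i$-th vertex: vertices of cyclically consecutive bags are all adjacent, vertices of non-consecutive distinct bags are non-adjacent, and each bag induces $B_i$. An admissible pattern for $k$ is a vector $(k_1,\dots,k_5)$ of positive integers with $k_i+k_{i+1}\le k-1$ for each $i$ modulo $5$ and $\sum_{i=1}^5 k_i=2k-1$. A pattern $(k_1,\dots,k_5)$ yields the buoys $(B_1,\dots,B_5)$ with $B_i\in\mathcal{C}_{k_i}$ for each $i$. Let $\mathcal{B}_k$ be the set of buoys yielded by the admissible patterns for $k$,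 and let $\mathcal{J}_k=\bigcup_{k_1+k_2=k,\ k_1,k_2\ge 1}\mathcal{C}_{k_1}\otimes\mathcal{C}_{k_2}$. Patterns are listed up to rotation and reflection, each once. Then the following hold. 1. $\mathcal{C}_1=\{K_1\}$, $\mathcal{C}_2=\{K_2\}$, $\mathcal{C}_3=\{K_3,C_5\}$ with $|\mathcal{C}_3|=2$; $\mathcal{B}_1=\mathcal{B}_2=\emptyset$ and $\mathcal{B}_3=\{C_5\}$. 2. $\mathcal{C}_4=\mathcal{J}_4\cup\mathcal{B}_4$. The only admissible pattern for $4$ is $(1,2,1,2,1)$, and $\mathcal{B}_4=\{T_3\}$. Moreover $\mathcal{J}_4=\mathcal{C}_1\otimes\mathcal{C}_3=\{T_1,T_2\}$. Hence $\mathcal{C}_4=\{T_1,T_2,T_3\}$ and $|\mathcal{C}_4|=3$. Here $T_1=K_4$; $T_2$ is the wheel consisting of a $5$-cycle and a vertex adjacent to all of it; and $T_3$ consists of a $5$-cycle $v_1v_2v_3v_4v_5$, a vertex adjacent to exactly $v_1,v_2,v_5$ and a vertex adjacent to exactly $v_2,v_3,v_4$. 3. $\mathcal{C}_5=\mathcal{J}_5\cup\mathcal{B}_5$.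 The admissible patterns for $5$ are $(2,2,2,2,1)$, $(2,1,3,1,2)$ and $(1,3,1,3,1)$. They yield, respectively, exactly the buoys $F_4=(K_2,K_2,K_2,K_2,K_1)$; $F_5=(K_2,K_1,K_3,K_1,K_2)$ and $F_6=(K_2,K_1,C_5,K_1,K_2)$; and $F_7=(K_1,K_3,K_1,K_3,K_1)$, $F_8=(K_1,K_3,K_1,C_5,K_1)$ and $F_9=(K_1,C_5,K_1,C_5,K_1)$; and $|\mathcal{B}_5|=6$. Moreover $\mathcal{J}_5=\mathcal{C}_1\otimes\mathcal{C}_4=\{F_1,F_2,F_3\}$, where $F_i$ is the join of $K_1$ and $T_i$. Hence $\mathcal{C}_5=\{F_1,\dots,F_9\}$ and $|\mathcal{C}_5|=9$. 4. $\mathcal{C}_6=\mathcal{J}_6\cup\mathcal{B}_6$. The admissible patterns for $6$ are $(2,2,2,2,3)$, $(2,3,2,3,1)$, $(2,3,1,3,2)$, $(1,4,1,3,2)$ and $(1,4,1,4,1)$; they yield $2$, $4$, $3$, $6$ and $6$ graphs respectively, $\mathcal{B}_6$ is the union of these five sets of graphs, and $|\mathcal{B}_6|=21$. Moreover $\mathcal{J}_6=(\mathcal{C}_1\otimes\mathcal{C}_5)\cup(\mathcal{B}_3\otimes\mathcal{B}_3)$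 and $|\mathcal{J}_6|=10$. Hence $|\mathcal{C}_6|=31$. -/

import Mathlib

open scoped SimpleGraph

/-- A finite simple graph. -/
structure FinGraph where
  /-- the vertex type -/
  V : Type
  finite : Finite V
  /-- the adjacency structure -/
  graph : SimpleGraph V

namespace FinGraph

/-- Isomorphism of finite graphs. -/
instance isoSetoid : Setoid FinGraph where
  r G H := Nonempty (G.graph ≃g H.graph)
  iseqv :=
    { refl := fun _ => ⟨SimpleGraph.Iso.refl⟩
      symm := fun ⟨e⟩ => ⟨e.symm⟩
      trans := fun ⟨e⟩ ⟨f⟩ => ⟨e.trans f⟩ }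

/-- Isomorphism classes of finite graphs. Sets of graphs are sets of such classes, so
that cardinalities count graphs up to isomorphism. -/
abbrev IsoClass : Type 1 := Quotient isoSetoid

/-- The isomorphism class of a finite graph. -/
def cls (G : FinGraph) : IsoClass := Quotient.mk isoSetoid G

/-- `G` is `k`-critical: `χ(G) = k`, and no proper induced subgraph has chromatic number `k`. -/
def IsCritical (G : FinGraph) (k : ℕ) : Prop :=
  G.graph.chromaticNumber = k ∧
    ∀ S : Set G.V, S ≠ Set.univ → (G.graph.induce S).chromaticNumber ≠ k

/-- `G` has no induced subgraph isomorphic to the path `P₅` on five vertices or to its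
complement. -/
def IsP5CoP5Free (G : FinGraph) : Prop :=
  ¬ SimpleGraph.pathGraph 5 ⊴ G.graph ∧ ¬ (SimpleGraph.pathGraph 5)ᶜ ⊴ G.graph

/-- The family `𝒞 k` of `k`-critical graphs without induced `P₅` or complement of `P₅`. -/
def critFamily (k : ℕ) : Set IsoClass :=
  cls '' {G | G.IsCritical k ∧ G.IsP5CoP5Free}

/-- The clique on `n` vertices. -/
def K (n : ℕ) : FinGraph := ⟨Fin n, inferInstance, ⊤⟩

/-- The cycle on five vertices. -/
def C5 : FinGraph := ⟨Fin 5, inferInstance, SimpleGraph.cycleGraph 5⟩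

/-- The join of two graphs: the disjoint union with all edges between the two sides added. -/
def join (G H : FinGraph) : FinGraph where
  V := G.V ⊕ H.V
  finite := by
    have := G.finite
    have := H.finite
    infer_instance
  graph := (G.graph ⊕g H.graph) ⊔ completeBipartiteGraph G.V H.V

/-- The buoy with bags `B 0, …, B 4`: the graph obtained from the cycle `C₅` by substituting
`B i` for the vertex `i`. Two vertices of the same bag are adjacent when they are so in that
bag; vertices of distinct bags `i`, `j` are adjacent when `i`, `j` are consecutive on `C₅`. -/
def buoy (B : Fin 5 → FinGraph) : FinGraph where
  V := Σ i, (B i).V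
  finite := by
    have := fun i => (B i).finite
    infer_instance
  graph :=
    { Adj := fun a b =>
        (SimpleGraph.cycleGraph 5).Adj a.1 b.1 ∨
          ∃ (i : Fin 5) (x y : (B i).V), a = ⟨i, x⟩ ∧ b = ⟨i, y⟩ ∧ (B i).graph.Adj x y
      symm := ⟨by
        rintro a b (h | ⟨i, x, y, ha, hb, h⟩)
        · exact Or.inl h.symm
        · exact Or.inr ⟨i, y, x, hb, ha, h.symm⟩⟩
      loopless := ⟨by
        rintro a (h | ⟨i, x, y, ha, hb, h⟩)
        · exact (SimpleGraph.cycleGraph 5).loopless.irrefl _ h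
        · rw [ha] at hb
          obtain rfl : x = y := by simpa using hb
          exact (B i).graph.loopless.irrefl x h⟩ }

/-- `𝒜 ⊗ ℬ`: the set of all joins of a member of `𝒜` and a member of `ℬ`. -/
def joinSet (A B : Set IsoClass) : Set IsoClass :=
  {c | ∃ G H : FinGraph, G.cls ∈ A ∧ H.cls ∈ B ∧ c = (join G H).cls}

/-- The vector `p` of positive integers is an admissible pattern for `k`: cyclically consecutive
entries satisfy `p i + p (i + 1) ≤ k - 1` (addition in `Fin 5` is modulo 5), and the sum of all
entries is `2 k - 1`. -/
def IsPattern (k : ℕ) (p : Fin 5 → ℕ) : Prop :=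
  (∀ i, 0 < p i) ∧ (∀ i, p i + p (i + 1) + 1 ≤ k) ∧ ∑ i, p i + 1 = 2 * k

/-- The buoys with pattern `p`: the `i`-th bag is a member of `𝒞 (p i)`. -/
def buoysOfPattern (p : Fin 5 → ℕ) : Set IsoClass :=
  {c | ∃ B : Fin 5 → FinGraph, (∀ i, (B i).cls ∈ critFamily (p i)) ∧ c = (buoy B).cls}

/-- `𝒥 k`: the joins of a member of `𝒞 k₁` and a member of `𝒞 k₂`, for positive integers
`k₁`, `k₂` with `k₁ + k₂ = k`. -/
def joinFamily (k : ℕ) : Set IsoClass :=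
  {c | ∃ k₁ k₂ : ℕ, 0 < k₁ ∧ 0 < k₂ ∧ k₁ + k₂ = k ∧
    c ∈ joinSet (critFamily k₁) (critFamily k₂)}

/-- `ℬ k`: the buoys whose pattern is admissible for `k`. -/
def buoyFamily (k : ℕ) : Set IsoClass :=
  {c | ∃ p, IsPattern k p ∧ c ∈ buoysOfPattern p}

/-- Two vectors agree up to a rotation or a reflection of the cyclic order of the indices. -/
def CircEquiv (p q : Fin 5 → ℕ) : Prop :=
  ∃ c : Fin 5, (∀ i, p i = q (c + i)) ∨ (∀ i, p i = q (c - i))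

/-- Up to rotation and reflection, the admissible patterns for `k` are exactly the members of
the list `L`, each of them once. -/
def PatternsAre (k : ℕ) (L : List (Fin 5 → ℕ)) : Prop :=
  (∀ p, IsPattern k p ↔ ∃ q ∈ L, CircEquiv p q) ∧ L.Pairwise fun p q => ¬ CircEquiv p q

/-- The 4-critical graph `T₁`, the clique on four vertices. -/
def T1 : FinGraph := K 4

/-- The 4-critical graph `T₂`, the wheel with five spokes: a cycle `0 1 2 3 4` and a vertex `5`
adjacent to all of it. -/
def T2 : FinGraph where
  V := Fin 6
  finite := inferInstance
  graph := SimpleGraph.fromEdgeSet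
    {s(0, 1), s(1, 2), s(2, 3), s(3, 4), s(4, 0),
      s(5, 0), s(5, 1), s(5, 2), s(5, 3), s(5, 4)}

/-- The 4-critical graph `T₃`: a cycle `0 1 2 3 4`, a vertex `5` adjacent to `0, 1, 4`, and a
vertex `6` adjacent to `1, 2, 3`. -/
def T3 : FinGraph where
  V := Fin 7
  finite := inferInstance
  graph := SimpleGraph.fromEdgeSet
    {s(0, 1), s(1, 2), s(2, 3), s(3, 4), s(4, 0),
      s(5, 0), s(5, 1), s(5, 4), s(6, 1), s(6, 2), s(6, 3)}

/-- The join of a single vertex with `T₁`. -/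
def F1 : FinGraph := join (K 1) T1

/-- The join of a single vertex with `T₂`. -/
def F2 : FinGraph := join (K 1) T2

/-- The join of a single vertex with `T₃`. -/
def F3 : FinGraph := join (K 1) T3

/-- The buoy with bags `K₂, K₂, K₂, K₂, K₁`. -/
def F4 : FinGraph := buoy ![K 2, K 2, K 2, K 2, K 1]

/-- The buoy with bags `K₂, K₁, K₃, K₁, K₂`. -/
def F5 : FinGraph := buoy ![K 2, K 1, K 3, K 1, K 2]

/-- The buoy with bags `K₂, K₁, C₅, K₁, K₂`. -/
def F6 : FinGraph := buoy ![K 2, K 1, C5, K 1, K 2]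

/-- The buoy with bags `K₁, K₃, K₁, K₃, K₁`. -/
def F7 : FinGraph := buoy ![K 1, K 3, K 1, K 3, K 1]

/-- The buoy with bags `K₁, K₃, K₁, C₅, K₁`. -/
def F8 : FinGraph := buoy ![K 1, K 3, K 1, C5, K 1]

/-- The buoy with bags `K₁, C₅, K₁, C₅, K₁`. -/
def F9 : FinGraph := buoy ![K 1, C5, K 1, C5, K 1]

end FinGraph

/-! The core is `critFamily_eq`: for `k ≥ 2` the critical graphs without induced `P₅` and house (the
complement of `P₅`) are exactly the joins of smaller ones and the buoys with admissible patterns.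

Decomposition (`IsSubst.join_or_buoy`). View `G` as a substitution into a quotient `Q`, starting
from `Q = G`. If `Q` contains an induced `C₅`, a maximum buoy in `Q` is a homogeneous set
(`exists_homogeneous_buoy`): it is either all of `Q`, and `G` is a buoy, or it can be contracted to
one vertex, giving a smaller quotient. If `Q` has no induced `C₅`, ordering vertices by decreasing
degree is a perfect order in Chvátal's sense, so the greedy colouring matches a clique
(`exists_clique_of_free`), also with vertex weights. Weighting each vertex by the chromatic number
of its fibre, criticality forces the heaviest clique to use every vertex (`IsSubst.adj_of_critOn`);
so `Q` is complete and `G` is a join.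

Arithmetic. Colouring a substitution means giving each quotient vertex a set of colours, disjoint
along edges and large enough for its fibre (`IsSubst.colOn_iff`). Hence fibres of critical graphs
are critical, and everything reduces to weights. A weighted `C₅` is colourable with `n` colours iff
adjacent weights sum to at most `n` and all weights to at most `2 n` (`exists_five`,
`sum_card_le_of_five`); criticality turns this into the conditions on patterns. Conversely, joins
and buoys create no new `P₅` or house outside a single part, because of the primeness of these two
graphs.

Enumeration. The families follow by recursion on `k`. Coincidences come from commutativity and
associativity of the join and from reflections of the cycle; all other pairs are told apart by the
number of vertices, the degree sum and the sum of squared degrees. -/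

namespace SimpleGraph

/-! ### Colourings, criticality and substitution -/

variable {V ι : Type*} {G : SimpleGraph V} {Q : SimpleGraph ι} {π : V → ι} {S T : Set V} {m n : ℕ}

/-- The vertices in `S` can be properly coloured with the colours `0, …, n - 1`. -/
def ColOn (G : SimpleGraph V) (S : Set V) (n : ℕ) : Prop :=
  ∃ c : V → ℕ, (∀ v ∈ S, c v < n) ∧ ∀ u ∈ S, ∀ v ∈ S, G.Adj u v → c u ≠ c v

/-- The subgraph induced by `S` is vertex-critical with chromatic number `m + 1`. -/
def CritOn (G : SimpleGraph V) (S : Set V) (m : ℕ) : Prop :=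
  ¬ G.ColOn S m ∧ ∀ v ∈ S, G.ColOn (S \ {v}) m

/-- `G` arises from `Q` by substituting for each vertex `i` the graph induced on the fibre of
`π` over `i`. -/
def IsSubst (G : SimpleGraph V) (Q : SimpleGraph ι) (π : V → ι) : Prop :=
  ∀ u v, π u ≠ π v → (G.Adj u v ↔ Q.Adj (π u) (π v))

theorem colOn_iff_colorable : G.ColOn S n ↔ (G.induce S).Colorable n := by
  constructor
  · rintro ⟨c, hc, hv⟩
    exact ⟨Coloring.mk (fun v => ⟨c v, hc v v.2⟩) fun {u v} h e =>
      hv u u.2 v v.2 h (congrArg Fin.val e)⟩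
  · rintro ⟨c⟩
    classical
    refine ⟨fun v => if h : v ∈ S then (c ⟨v, h⟩ : ℕ) else 0, fun v hv => ?_,
      fun u hu v hv h => ?_⟩
    · simp [hv]
    · simp only [hu, hv, dite_true]
      exact fun e => c.valid (v := ⟨u, hu⟩) (w := ⟨v, hv⟩) h (Fin.ext e)

theorem ColOn.mono_set (h : G.ColOn T n) (hS : S ⊆ T) : G.ColOn S n := by
  obtain ⟨c, h1, h2⟩ := h
  exact ⟨c, fun v hv => h1 v (hS hv), fun u hu v hv => h2 u (hS hu) v (hS hv)⟩

theorem ColOn.mono (h : G.ColOn S m) (hm : m ≤ n) : G.ColOn S n := by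
  obtain ⟨c, h1, h2⟩ := h
  exact ⟨c, fun v hv => (h1 v hv).trans_le hm, h2⟩

theorem ColOn.of_diff_singleton {v : V} (h : G.ColOn (S \ {v}) n) : G.ColOn S (n + 1) := by
  classical
  obtain ⟨c, h1, h2⟩ := h
  refine ⟨fun u => if u = v then n else c u, fun u hu => ?_, fun u hu w hw a => ?_⟩
  · by_cases e : u = v
    · simp [e]
    · simpa [e] using (h1 u ⟨hu, e⟩).trans (Nat.lt_succ_self n)
  · by_cases e : u = v <;> by_cases e' : w = v
    · exact absurd (e.trans e'.symm) a.ne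
    · simpa [e, e'] using (h1 w ⟨hw, e'⟩).ne'
    · simpa [e, e'] using (h1 u ⟨hu, e⟩).ne
    · simpa [e, e'] using h2 u ⟨hu, e⟩ w ⟨hw, e'⟩ a

theorem ColOn.empty : G.ColOn ∅ n := ⟨fun _ => 0, by simp, by simp⟩

theorem exists_colOn [Finite V] : ∃ n, G.ColOn S n := by
  obtain ⟨n, ⟨e⟩⟩ := Finite.exists_equiv_fin V
  exact ⟨n, fun v => e v, fun v _ => (e v).2, fun u _ v _ h he =>
    h.ne (e.injective (Fin.ext he))⟩

theorem CritOn.nonempty (h : G.CritOn S m) : S.Nonempty := by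
  by_contra hS
  rw [Set.not_nonempty_iff_eq_empty] at hS
  subst hS
  exact h.1 ColOn.empty

theorem CritOn.colOn (h : G.CritOn S m) : G.ColOn S (m + 1) := by
  obtain ⟨v, hv⟩ := h.nonempty
  exact (h.2 v hv).of_diff_singleton

theorem CritOn.lt_of_colOn (h : G.CritOn S m) (hn : G.ColOn S n) : m + 1 ≤ n := by
  by_contra! hlt
  exact h.1 (hn.mono (by omega))

theorem CritOn.le_of_diff (h : G.CritOn S m) {v : V} (hn : G.ColOn (S \ {v}) n) : m ≤ n := by
  have := h.lt_of_colOn hn.of_diff_singleton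
  omega

theorem colOn_induce_iff {F : Set V} {T : Set F} :
    (G.induce F).ColOn T n ↔ G.ColOn (Subtype.val '' T) n := by
  classical
  constructor
  · rintro ⟨c, h1, h2⟩
    refine ⟨fun v => if h : v ∈ F then c ⟨v, h⟩ else 0, ?_, ?_⟩
    · rintro _ ⟨v, hv, rfl⟩
      simpa using h1 v hv
    · rintro _ ⟨u, hu, rfl⟩ _ ⟨v, hv, rfl⟩ h
      simpa using h2 u hu v hv h
  · rintro ⟨c, h1, h2⟩
    exact ⟨fun v => c v, fun v hv => h1 _ ⟨v, hv, rfl⟩,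
      fun u hu v hv h => h2 _ ⟨u, hu, rfl⟩ _ ⟨v, hv, rfl⟩ h⟩

theorem critOn_induce_univ_iff {F : Set V} :
    (G.induce F).CritOn Set.univ m ↔ G.CritOn F m := by
  have key : ∀ v : F, Subtype.val '' (Set.univ \ {v}) = F \ {(v : V)} := by
    intro v
    ext x
    simp only [Set.mem_image, Set.mem_sdiff, Set.mem_univ, Set.mem_singleton_iff, true_and,
      Subtype.exists, exists_and_right, exists_eq_right]
    constructor
    · rintro ⟨hx, hne⟩
      exact ⟨hx, fun e => hne (Subtype.ext e)⟩
    · rintro ⟨hx, hne⟩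
      exact ⟨hx, fun e => hne (congrArg Subtype.val e)⟩
  simp only [CritOn, colOn_induce_iff, key, Set.image_univ, Subtype.range_coe]
  simp

theorem IsSubst.comp {κ : Type*} {R : SimpleGraph κ} {ρ : ι → κ} (h : IsSubst G Q π)
    (h' : IsSubst Q R ρ) : IsSubst G R (ρ ∘ π) := fun u v huv =>
  (h u v fun e => huv (congrArg ρ e)).trans (h' _ _ huv)

/-- Colourings of a substitution correspond to set-colourings of the pattern graph. -/
theorem IsSubst.colOn_iff (h : IsSubst G Q π) :
    G.ColOn S n ↔ ∃ A : ι → Finset ℕ, (∀ i, A i ⊆ Finset.range n) ∧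
      (∀ i j, Q.Adj i j → Disjoint (A i) (A j)) ∧
      ∀ i, G.ColOn (S ∩ π ⁻¹' {i}) (A i).card := by
  classical
  constructor
  · rintro ⟨c, h1, h2⟩
    -- `A i` is the set of colours that appear on the fibre over `i`.
    let A : ι → Finset ℕ := fun i =>
      (Finset.range n).filter fun a => ∃ v ∈ S, π v = i ∧ c v = a
    refine ⟨A, fun i => Finset.filter_subset _ _, fun i j hij => ?_, fun i => ?_⟩
    · rw [Finset.disjoint_left]
      intro a ha hb
      obtain ⟨-, u, hu, rfl, rfl⟩ := Finset.mem_filter.1 ha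
      obtain ⟨-, v, hv, rfl, hc⟩ := Finset.mem_filter.1 hb
      exact h2 u hu v hv ((h u v hij.ne).2 hij) hc.symm
    · let e := (A i).equivFin
      refine ⟨fun v => if hv : c v ∈ A i then e ⟨c v, hv⟩ else 0, ?_, ?_⟩
      · rintro v ⟨hv, hi⟩
        have : c v ∈ A i := Finset.mem_filter.2 ⟨Finset.mem_range.2 (h1 v hv), v, hv, hi, rfl⟩
        simp [this]
      · rintro u ⟨hu, hi⟩ v ⟨hv, hj⟩ hadj
        have hu' : c u ∈ A i := Finset.mem_filter.2 ⟨Finset.mem_range.2 (h1 u hu), u, hu, hi, rfl⟩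
        have hv' : c v ∈ A i := Finset.mem_filter.2 ⟨Finset.mem_range.2 (h1 v hv), v, hv, hj, rfl⟩
        simp only [hu', hv', dite_true]
        intro he
        have := e.injective (Fin.ext he)
        exact h2 u hu v hv hadj (congrArg Subtype.val this)
  · rintro ⟨A, hA, hd, hc⟩
    choose c h1 h2 using hc
    -- Each fibre is coloured with `0, …, |A i| - 1`; these colours are renamed injectively into `A
    -- i`.
    let e : ∀ i, Fin (A i).card ≃ A i := fun i => (A i).equivFin.symm
    let f : ι → ℕ → ℕ := fun i a => if ha : a < (A i).card then (e i ⟨a, ha⟩ : ℕ) else 0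
    have hf : ∀ i a, a < (A i).card → f i a ∈ A i := by
      intro i a ha
      simp only [f, ha, dite_true]
      exact (e i ⟨a, ha⟩).2
    have hinj : ∀ i a b, a < (A i).card → b < (A i).card → f i a = f i b → a = b := by
      intro i a b ha hb hab
      simp only [f, ha, hb, dite_true] at hab
      simpa using (e i).injective (Subtype.ext hab)
    refine ⟨fun v => f (π v) (c (π v) v), fun v hv => ?_, fun u hu v hv hadj he => ?_⟩
    · exact Finset.mem_range.1 (hA _ (hf _ _ (h1 _ v ⟨hv, rfl⟩)))
    · have mu := hf _ _ (h1 _ u ⟨hu, rfl⟩)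
      have mv := hf _ _ (h1 _ v ⟨hv, rfl⟩)
      by_cases huv : π u = π v
      · simp only [huv] at he
        exact h2 (π v) u ⟨hu, huv⟩ v ⟨hv, rfl⟩ hadj
          (hinj _ _ _ (h1 _ u ⟨hu, huv⟩) (h1 _ v ⟨hv, rfl⟩) he)
      · have := Finset.disjoint_left.1 (hd _ _ ((h u v huv).1 hadj)) mu
        exact this (by rw [show f (π u) (c (π u) u) = f (π v) (c (π v) v) from he]; exact mv)

theorem IsSubst.colOn_univ_of (h : IsSubst G Q π) (k : ι → ℕ)
    (hk : ∀ i, G.ColOn (π ⁻¹' {i}) (k i)) (A : ι → Finset ℕ) (hA : ∀ i, A i ⊆ Finset.range n)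
    (hd : ∀ i j, Q.Adj i j → Disjoint (A i) (A j)) (hc : ∀ i, k i ≤ (A i).card) :
    G.ColOn Set.univ n :=
  h.colOn_iff.2 ⟨A, hA, hd, fun i => by simpa using (hk i).mono (hc i)⟩

/-- The fibres of a substitution that is critical are critical themselves. -/
theorem IsSubst.exists_critOn_fiber [Finite V] (h : IsSubst G Q π) (hG : G.CritOn Set.univ m)
    {i : ι} (hi : (π ⁻¹' {i}).Nonempty) : ∃ w, G.CritOn (π ⁻¹' {i}) w := by
  classical
  have hex : ∃ n, G.ColOn (π ⁻¹' {i}) n := exists_colOn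
  obtain ⟨v₀, hv₀⟩ := hi
  have hpos : Nat.find hex ≠ 0 := by
    intro h0
    obtain ⟨c, hc, -⟩ := h0 ▸ Nat.find_spec hex
    exact absurd (hc v₀ hv₀) (Nat.not_lt_zero _)
  obtain ⟨w, hw⟩ := Nat.exists_eq_succ_of_ne_zero hpos
  refine ⟨w, Nat.find_min hex (by omega), fun v hv => ?_⟩
  obtain ⟨A, hA, hd, hc⟩ := h.colOn_iff.1 (hG.2 v trivial)
  have hset : (Set.univ \ {v}) ∩ π ⁻¹' {i} = π ⁻¹' {i} \ {v} := by
    ext x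
    simp [and_comm]
  -- In an `m`-colouring of `G - v` the fibre minus `v` gets `A i`. With at most `w` colours this is
  -- the claim; with more, the whole fibre, `v` included, could be recoloured from `A i`, and `G`
  -- would be `m`-colourable.
  by_cases hlt : (A i).card ≤ w
  · have := (hc i).mono hlt
    rwa [hset] at this
  · refine absurd (h.colOn_iff.2 ⟨A, hA, hd, fun j => ?_⟩) hG.1
    by_cases hj : j = i
    · subst hj
      simpa using (Nat.find_spec hex).mono (by omega)
    · refine (hc j).mono_set ?_
      rintro x ⟨-, hx⟩
      refine ⟨⟨trivial, ?_⟩, hx⟩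
      rintro rfl
      exact hj (hx.symm.trans hv)

theorem preimage_diff_of_ne {v : V} {i : ι} (hv : π v ≠ i) :
    (Set.univ \ {v}) ∩ π ⁻¹' {i} = π ⁻¹' {i} := by
  ext x
  simp only [Set.mem_inter_iff, Set.mem_sdiff, Set.mem_univ, Set.mem_singleton_iff, true_and,
    Set.mem_preimage, and_iff_right_iff_imp]
  rintro rfl rfl
  exact hv rfl

theorem preimage_diff_self {v : V} :
    (Set.univ \ {v}) ∩ π ⁻¹' {π v} = π ⁻¹' {π v} \ {v} := by
  ext x
  simp [and_comm]

/-- A colouring of `G - v` for a substitution with critical fibres. -/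
theorem IsSubst.colOn_diff_of (h : IsSubst G Q π) {w : ι → ℕ}
    (hw : ∀ i, G.CritOn (π ⁻¹' {i}) (w i)) (v : V) (A : ι → Finset ℕ)
    (hA : ∀ i, A i ⊆ Finset.range n) (hd : ∀ i j, Q.Adj i j → Disjoint (A i) (A j))
    (hc : ∀ i, i ≠ π v → w i + 1 ≤ (A i).card) (hv : w (π v) ≤ (A (π v)).card) :
    G.ColOn (Set.univ \ {v}) n := by
  refine h.colOn_iff.2 ⟨A, hA, hd, fun i => ?_⟩
  by_cases hi : i = π v
  · subst hi
    rw [preimage_diff_self]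
    exact ((hw _).2 v rfl).mono hv
  · rw [preimage_diff_of_ne (Ne.symm hi)]
    exact (hw i).colOn.mono (hc i hi)

/-- The colour sets of a colouring of `G - v` for a substitution with critical fibres. -/
theorem IsSubst.exists_of_colOn_diff (h : IsSubst G Q π) {w : ι → ℕ}
    (hw : ∀ i, G.CritOn (π ⁻¹' {i}) (w i)) {v : V} (hG : G.ColOn (Set.univ \ {v}) n) :
    ∃ A : ι → Finset ℕ, (∀ i, A i ⊆ Finset.range n) ∧
      (∀ i j, Q.Adj i j → Disjoint (A i) (A j)) ∧ (∀ i, i ≠ π v → w i + 1 ≤ (A i).card) ∧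
      w (π v) ≤ (A (π v)).card := by
  obtain ⟨A, hA, hd, hc⟩ := h.colOn_iff.1 hG
  refine ⟨A, hA, hd, fun i hi => ?_, ?_⟩
  · have := hc i
    rw [preimage_diff_of_ne (Ne.symm hi)] at this
    exact (hw i).lt_of_colOn this
  · have := hc (π v)
    rw [preimage_diff_self] at this
    exact (hw _).le_of_diff this

theorem IsSubst.exists_of_colOn (h : IsSubst G Q π) {w : ι → ℕ}
    (hw : ∀ i, G.CritOn (π ⁻¹' {i}) (w i)) (hG : G.ColOn Set.univ n) :
    ∃ A : ι → Finset ℕ, (∀ i, A i ⊆ Finset.range n) ∧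
      (∀ i j, Q.Adj i j → Disjoint (A i) (A j)) ∧ ∀ i, w i + 1 ≤ (A i).card := by
  obtain ⟨A, hA, hd, hc⟩ := h.colOn_iff.1 hG
  exact ⟨A, hA, hd, fun i => (hw i).lt_of_colOn (by simpa using hc i)⟩

theorem exists_disjoint_pair {a b : ℕ} (hab : a + b ≤ n) :
    ∃ A : Bool → Finset ℕ, (∀ i, A i ⊆ Finset.range n) ∧
      (∀ i j, (⊤ : SimpleGraph Bool).Adj i j → Disjoint (A i) (A j)) ∧
      (A false).card = a ∧ (A true).card = b := by
  have hdis : Disjoint (Finset.range a) (Finset.Ico a (a + b)) := by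
    rw [Finset.disjoint_left]
    intro x hx hy
    simp only [Finset.mem_range, Finset.mem_Ico] at hx hy
    omega
  refine ⟨fun i => cond i (Finset.Ico a (a + b)) (Finset.range a), ?_, ?_, by simp, by simp⟩
  · intro i x hx
    cases i <;> simp at hx ⊢ <;> omega
  · intro i j hij
    cases i <;> cases j <;> simp at hij ⊢
    · exact hdis
    · exact hdis.symm

theorem card_add_le_of_disjoint {A B : Finset ℕ} (hA : A ⊆ Finset.range n)
    (hB : B ⊆ Finset.range n) (h : Disjoint A B) : A.card + B.card ≤ n := by
  rw [← Finset.card_union_of_disjoint h]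
  simpa using Finset.card_le_card (Finset.union_subset hA hB)

/-- A join of two critical graphs is critical. -/
theorem IsSubst.critOn_of_top {π : V → Bool}
    (h : IsSubst G (⊤ : SimpleGraph Bool) π) {w : Bool → ℕ}
    (hw : ∀ i, G.CritOn (π ⁻¹' {i}) (w i)) : G.CritOn Set.univ (w false + w true + 1) := by
  constructor
  · intro hc
    obtain ⟨A, hA, hd, hc⟩ := h.exists_of_colOn hw hc
    have := card_add_le_of_disjoint (hA false) (hA true) (hd _ _ (by simp))
    have := hc false
    have := hc true
    omega
  · intro v _
    -- The sides have chromatic numbers `w false + 1` and `w true + 1`; the side of `v` now needs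
    -- one colour fewer, so `w false + w true + 1` colours suffice.
    cases hv : π v
    · obtain ⟨A, hA, hd, h0, h1⟩ := exists_disjoint_pair
        (show w false + (w true + 1) ≤ w false + w true + 1 by omega)
      refine h.colOn_diff_of hw v A hA hd (fun i hi => ?_) ?_
      · cases i <;> simp_all
      · rw [hv, h0]
    · obtain ⟨A, hA, hd, h0, h1⟩ := exists_disjoint_pair
        (show w false + 1 + w true ≤ w false + w true + 1 by omega)
      refine h.colOn_diff_of hw v A hA hd (fun i hi => ?_) ?_
      · cases i <;> simp_all
      · rw [hv, h1]

theorem CritOn.unique {m' : ℕ} (h : G.CritOn S m) (h' : G.CritOn S m') : m = m' := by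
  have := h.lt_of_colOn h'.colOn
  have := h'.lt_of_colOn h.colOn
  omega

/-! ### Weighted colourings of the five-cycle and admissible patterns -/

/-- Weighted colourings of the five-cycle when three consecutive weights fit together. -/
theorem exists_five_of_triple {a b c d e : ℕ} (h3 : e + a + b ≤ n) (hbc : b + c ≤ n)
    (hcd : c + d ≤ n) (hde : d + e ≤ n) :
    ∃ A B C D E : Finset ℕ, (A ⊆ Finset.range n ∧ B ⊆ Finset.range n ∧ C ⊆ Finset.range n ∧
      D ⊆ Finset.range n ∧ E ⊆ Finset.range n) ∧ (A.card = a ∧ B.card = b ∧ C.card = c ∧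
      D.card = d ∧ E.card = e) ∧ Disjoint A B ∧ Disjoint B C ∧ Disjoint C D ∧ Disjoint D E ∧
      Disjoint E A := by
  -- `B` and `D` are taken from the bottom, `C` and `E` from the top; `h3` leaves room for `A`
  -- between `B` and `E`.
  refine ⟨Finset.Ico b (b + a), Finset.Ico 0 b, Finset.Ico (n - c) n, Finset.Ico 0 d,
    Finset.Ico (n - e) n, ⟨?_, ?_, ?_, ?_, ?_⟩, ⟨?_, ?_, ?_, ?_, ?_⟩, ?_, ?_, ?_, ?_, ?_⟩
  all_goals
    first
    | (intro x hx; simp only [Finset.mem_Ico, Finset.mem_range] at hx ⊢; omega)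
    | (simp only [Nat.card_Ico]; omega)
    | (rw [Finset.disjoint_left]; intro x hx hy; simp only [Finset.mem_Ico] at hx hy; omega)

/-- Weighted colourings of the five-cycle when no three consecutive weights fit together. -/
theorem exists_five_of_not_triple {a b c d e : ℕ} (hab : a + b ≤ n) (hbc : b + c ≤ n)
    (hea : e + a ≤ n) (hs : a + b + c + d + e ≤ 2 * n)
    (h1 : n < a + b + c) (h2 : n < e + a + b) :
    ∃ A B C D E : Finset ℕ, (A ⊆ Finset.range n ∧ B ⊆ Finset.range n ∧ C ⊆ Finset.range n ∧
      D ⊆ Finset.range n ∧ E ⊆ Finset.range n) ∧ (A.card = a ∧ B.card = b ∧ C.card = c ∧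
      D.card = d ∧ E.card = e) ∧ Disjoint A B ∧ Disjoint B C ∧ Disjoint C D ∧ Disjoint D E ∧
      Disjoint E A := by
  -- `A` and `B` fill the bottom. `C` takes all colours above them and, these being too few by `h1`,
  -- the lowest `a + b + c - n` colours of `A`. `D` starts right after this part and `E` sits at the
  -- top: `hs` separates `D` from `E`, and with `h2` also `D` from the upper part of `C`.
  refine ⟨Finset.Ico 0 a, Finset.Ico a (a + b),
    Finset.Ico 0 (a + b + c - n) ∪ Finset.Ico (a + b) n,
    Finset.Ico (a + b + c - n) (a + b + c - n + d), Finset.Ico (n - e) n,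
    ⟨?_, ?_, ?_, ?_, ?_⟩, ⟨?_, ?_, ?_, ?_, ?_⟩, ?_, ?_, ?_, ?_, ?_⟩
  all_goals
    first
    | (intro x hx; simp only [Finset.mem_Ico, Finset.mem_range, Finset.mem_union] at hx ⊢; omega)
    | (simp only [Nat.card_Ico]; omega)
    | (rw [Finset.disjoint_left]; intro x hx hy
       simp only [Finset.mem_Ico, Finset.mem_union] at hx hy; omega)
    | (rw [Finset.card_union_of_disjoint]
       · simp only [Nat.card_Ico]; omega
       · rw [Finset.disjoint_left]; intro x hx hy; simp only [Finset.mem_Ico] at hx hy; omega)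

theorem cycleGraph_five_adj {i j : Fin 5} :
    (cycleGraph 5).Adj i j ↔ j = i + 1 ∨ i = j + 1 := by
  revert i j
  decide

/-- The explicit constructions single out a position on the cycle; this lets that position be any
`r`. -/
theorem exists_five_rotate {k : Fin 5 → ℕ} (r : Fin 5)
    (h : ∃ A B C D E : Finset ℕ, (A ⊆ Finset.range n ∧ B ⊆ Finset.range n ∧ C ⊆ Finset.range n ∧
      D ⊆ Finset.range n ∧ E ⊆ Finset.range n) ∧ (A.card = k r ∧ B.card = k (r + 1) ∧
      C.card = k (r + 2) ∧ D.card = k (r + 3) ∧ E.card = k (r + 4)) ∧ Disjoint A B ∧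
      Disjoint B C ∧ Disjoint C D ∧ Disjoint D E ∧ Disjoint E A) :
    ∃ A : Fin 5 → Finset ℕ, (∀ i, A i ⊆ Finset.range n) ∧ (∀ i, (A i).card = k i) ∧
      ∀ i j, (cycleGraph 5).Adj i j → Disjoint (A i) (A j) := by
  obtain ⟨A, B, C, D, E, ⟨a1, a2, a3, a4, a5⟩, ⟨b1, b2, b3, b4, b5⟩, c1, c2, c3, c4, c5⟩ := h
  have key : ∃ F : Fin 5 → Finset ℕ, (∀ i, F i ⊆ Finset.range n) ∧
      (∀ i, (F i).card = k (r + i)) ∧ ∀ i, Disjoint (F i) (F (i + 1)) := by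
    refine ⟨![A, B, C, D, E], fun i => ?_, fun i => ?_, fun i => ?_⟩ <;> fin_cases i
    all_goals first | assumption | simpa
  obtain ⟨F, f1, f2, f3⟩ := key
  refine ⟨fun i => F (i - r), fun i => f1 _, fun i => ?_, fun i j hij => ?_⟩
  · rw [f2]
    congr 1
    abel
  · rcases cycleGraph_five_adj.1 hij with rfl | rfl
    · have := f3 (i - r)
      rwa [show i - r + 1 = i + 1 - r by abel] at this
    · have := (f3 (j - r)).symm
      rwa [show j - r + 1 = j + 1 - r by abel] at this

/-- Weighted colourings of the five-cycle. -/
theorem exists_five {k : Fin 5 → ℕ} (hp : ∀ i, k i + k (i + 1) ≤ n) (hs : ∑ i, k i ≤ 2 * n) :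
    ∃ A : Fin 5 → Finset ℕ, (∀ i, A i ⊆ Finset.range n) ∧ (∀ i, (A i).card = k i) ∧
      ∀ i j, (cycleGraph 5).Adj i j → Disjoint (A i) (A j) := by
  by_cases ht : ∃ r, k (r + 4) + k r + k (r + 1) ≤ n
  · obtain ⟨r, hr⟩ := ht
    have p1 := hp (r + 1)
    have p2 := hp (r + 2)
    have p3 := hp (r + 3)
    simp only [add_assoc, show (1 + 1 : Fin 5) = 2 from rfl, show (2 + 1 : Fin 5) = 3 from rfl,
      show (3 + 1 : Fin 5) = 4 from rfl] at p1 p2 p3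
    exact exists_five_rotate r (exists_five_of_triple hr p1 p2 p3)
  · push Not at ht
    have h0 := ht 0
    have h1 := ht 1
    have p0 := hp 0
    have p1 := hp 1
    have p4 := hp 4
    simp only [Fin.sum_univ_five] at hs
    simp only [show (0 + 4 : Fin 5) = 4 from rfl, show (0 + 1 : Fin 5) = 1 from rfl,
      show (1 + 4 : Fin 5) = 0 from rfl, show (1 + 1 : Fin 5) = 2 from rfl,
      show (4 + 1 : Fin 5) = 0 from rfl] at h0 h1 p0 p1 p4
    exact exists_five_rotate 0 (exists_five_of_not_triple p0 p1 p4 hs h1 h0)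

/-- Double counting: the indices whose sets contain a given colour form a stable set of `C₅`, so
there are at most two of them. -/
theorem sum_card_le_of_five {A : Fin 5 → Finset ℕ} (hA : ∀ i, A i ⊆ Finset.range n)
    (hd : ∀ i j, (cycleGraph 5).Adj i j → Disjoint (A i) (A j)) :
    ∑ i, (A i).card ≤ 2 * n := by
  have hst : ∀ s : Finset (Fin 5), (∀ i ∈ s, i + 1 ∉ s) → s.card ≤ 2 := by decide
  have h1 : ∀ i, (A i).card = ∑ c ∈ Finset.range n, if c ∈ A i then 1 else 0 := by
    intro i
    rw [Finset.sum_boole, Finset.filter_mem_eq_inter, Finset.inter_eq_right.2 (hA i)]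
    simp
  simp only [h1]
  rw [Finset.sum_comm]
  calc _ ≤ ∑ c ∈ Finset.range n, 2 := Finset.sum_le_sum fun c _ => ?_
    _ = 2 * n := by simp [mul_comm]
  rw [Finset.sum_boole]
  refine hst _ fun i hi hi' => ?_
  simp only [Finset.mem_filter, Finset.mem_univ, true_and] at hi hi'
  exact Finset.disjoint_left.1 (hd i (i + 1) (cycleGraph_five_adj.2 (Or.inl rfl))) hi hi'

/-- A buoy with critical bags and an admissible pattern is critical. -/
theorem IsSubst.critOn_of_cycle {π : V → Fin 5} (h : IsSubst G (cycleGraph 5) π) {w : Fin 5 → ℕ}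
    (hw : ∀ i, G.CritOn (π ⁻¹' {i}) (w i)) (hp : ∀ i, w i + 1 + (w (i + 1) + 1) ≤ m)
    (hs : ∑ i, (w i + 1) = 2 * m + 1) : G.CritOn Set.univ m := by
  constructor
  · intro hc
    obtain ⟨A, hA, hd, hc⟩ := h.exists_of_colOn hw hc
    have h1 := sum_card_le_of_five hA hd
    have h2 : ∑ i, (w i + 1) ≤ ∑ i, (A i).card := Finset.sum_le_sum fun i _ => hc i
    omega
  · intro v _
    -- Deleting `v` lowers the weight of its bag by one, so the total drops from `2 m + 1` to `2 m`,
    -- just enough for `exists_five`.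
    let k : Fin 5 → ℕ := fun i => if i = π v then w i else w i + 1
    have hk : ∀ i, k i ≤ w i + 1 := by
      intro i
      simp only [k]
      split_ifs <;> omega
    have hlt : ∑ i, k i < ∑ i, (w i + 1) :=
      Finset.sum_lt_sum (fun i _ => hk i) ⟨π v, Finset.mem_univ _, by simp [k]⟩
    obtain ⟨A, hA, hc, hd⟩ := exists_five (n := m) (k := k)
      (fun i => (add_le_add (hk _) (hk _)).trans (hp i)) (by omega)
    refine h.colOn_diff_of hw v A hA hd (fun i hi => ?_) ?_
    · simp [hc, k, hi]
    · simp [hc, k]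

/-- The pattern of a critical buoy is admissible. -/
theorem IsSubst.pattern_of_critOn {π : V → Fin 5} (h : IsSubst G (cycleGraph 5) π) {w : Fin 5 → ℕ}
    (hw : ∀ i, G.CritOn (π ⁻¹' {i}) (w i)) (hG : G.CritOn Set.univ m) :
    (∀ i, w i + 1 + (w (i + 1) + 1) ≤ m) ∧ ∑ i, (w i + 1) = 2 * m + 1 := by
  have hpair : ∀ i, w i + 1 + (w (i + 1) + 1) ≤ m := by
    intro i
    -- Deleting a vertex from a bag other than `i` and `i + 1` leaves both of these at full weight
    -- in an `m`-colouring.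
    obtain ⟨v, hv⟩ := (hw (i + 3)).nonempty
    obtain ⟨A, hA, hd, hc, -⟩ := h.exists_of_colOn_diff hw (hG.2 v trivial)
    have hv' : π v = i + 3 := hv
    rw [hv'] at hc
    have hne : ∀ i : Fin 5, i ≠ i + 3 ∧ i + 1 ≠ i + 3 := by decide
    have h1 := hc i (hne i).1
    have h2 := hc (i + 1) (hne i).2
    have := card_add_le_of_disjoint (hA i) (hA (i + 1))
      (hd _ _ (cycleGraph_five_adj.2 (Or.inl rfl)))
    omega
  refine ⟨hpair, le_antisymm ?_ ?_⟩
  · obtain ⟨v, hv⟩ := (hw 0).nonempty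
    obtain ⟨A, hA, hd, hc, hc'⟩ := h.exists_of_colOn_diff hw (hG.2 v trivial)
    have hv' : π v = 0 := hv
    rw [hv'] at hc hc'
    have h1 := sum_card_le_of_five hA hd
    have a1 := hc 1 (by decide)
    have a2 := hc 2 (by decide)
    have a3 := hc 3 (by decide)
    have a4 := hc 4 (by decide)
    simp only [Fin.sum_univ_five] at h1 ⊢
    omega
  -- A total of at most `2 m`, together with `hpair`, would give an `m`-colouring of all of `G`.
  · by_contra! hlt
    obtain ⟨A, hA, hc, hd⟩ := exists_five (n := m) (k := fun i => w i + 1) hpair (by omega)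
    exact hG.1 (h.colOn_univ_of (fun i => w i + 1) (fun i => (hw i).colOn) A hA hd
      fun i => (hc i).ge)

end SimpleGraph

/-! ### Perfection of graphs without induced `P₅`, house and `C₅` -/

namespace SimpleGraph

variable {V ι : Type*} {G : SimpleGraph V}

/-- The condition `hH` says that `H` has no false twins; then a map preserving adjacency and
non-adjacency is automatically injective, so distinctness of the images need not be checked. -/
theorem isIndContained_of_five {H : SimpleGraph (Fin 5)}
    (hH : ∀ i j, i ≠ j → H.Adj i j ∨ ∃ k, ¬ (H.Adj i k ↔ H.Adj j k)) (f : Fin 5 → V)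
    (hf : ∀ i j, i < j → (H.Adj i j ↔ G.Adj (f i) (f j))) : H ⊴ G := by
  have hf' : ∀ i j, H.Adj i j ↔ G.Adj (f i) (f j) := by
    intro i j
    rcases lt_trichotomy i j with h | rfl | h
    · exact hf i j h
    · simp
    · rw [H.adj_comm, G.adj_comm]
      exact hf j i h
  refine ⟨⟨⟨f, fun i j hij => ?_⟩, fun {i j} => (hf' i j).symm⟩⟩
  by_contra hne
  rcases hH i j hne with h | ⟨k, hk⟩
  · exact ((hf' i j).1 h).ne hij
  · exact hk (by rw [hf', hf', hij])

instance : DecidableRel (pathGraph 5).Adj := fun _ _ => decidable_of_iff _ pathGraph_adj.symm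

theorem pathGraph_five_isIndContained {a b c d e : V} (ab : G.Adj a b) (bc : G.Adj b c)
    (cd : G.Adj c d) (de : G.Adj d e) (ac : ¬ G.Adj a c) (ad : ¬ G.Adj a d) (ae : ¬ G.Adj a e)
    (bd : ¬ G.Adj b d) (be : ¬ G.Adj b e) (ce : ¬ G.Adj c e) : pathGraph 5 ⊴ G := by
  refine isIndContained_of_five (by decide) ![a, b, c, d, e] fun i j hij => ?_
  fin_cases i <;> fin_cases j <;> first | (exfalso; revert hij; decide) | simp [pathGraph_adj, *]

theorem compl_pathGraph_five_isIndContained {a b c d e : V} (ab : ¬ G.Adj a b)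
    (bc : ¬ G.Adj b c) (cd : ¬ G.Adj c d) (de : ¬ G.Adj d e) (ac : G.Adj a c) (ad : G.Adj a d)
    (ae : G.Adj a e) (bd : G.Adj b d) (be : G.Adj b e) (ce : G.Adj c e) :
    (pathGraph 5)ᶜ ⊴ G := by
  refine isIndContained_of_five (by decide) ![a, b, c, d, e] fun i j hij => ?_
  fin_cases i <;> fin_cases j <;> first | (exfalso; revert hij; decide) | simp [pathGraph_adj, *]

theorem cycleGraph_five_isIndContained {a b c d e : V} (ab : G.Adj a b) (bc : G.Adj b c)
    (cd : G.Adj c d) (de : G.Adj d e) (ea : G.Adj e a) (ac : ¬ G.Adj a c) (bd : ¬ G.Adj b d)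
    (ce : ¬ G.Adj c e) (da : ¬ G.Adj d a) (eb : ¬ G.Adj e b) : cycleGraph 5 ⊴ G := by
  rw [G.adj_comm] at ea da eb
  refine isIndContained_of_five (by decide) ![a, b, c, d, e] fun i j hij => ?_
  fin_cases i <;> fin_cases j <;>
    first | (exfalso; revert hij; decide) | (rw [cycleGraph_five_adj]; simp [*])

/-- In a graph without induced `P₅`, `C₅` and house, a vertex `x` adjacent to the end `a` of an
induced path `a b c d`, but not to `b`, is adjacent to `c` and not to `d`. -/
theorem adj_of_adj_end (h1 : ¬ pathGraph 5 ⊴ G) (h2 : ¬ (pathGraph 5)ᶜ ⊴ G)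
    (h3 : ¬ cycleGraph 5 ⊴ G) {a b c d x : V} (ab : G.Adj a b) (bc : G.Adj b c)
    (cd : G.Adj c d) (ac : ¬ G.Adj a c) (ad : ¬ G.Adj a d) (bd : ¬ G.Adj b d)
    (xa : G.Adj x a) (xb : ¬ G.Adj x b) : G.Adj x c ∧ ¬ G.Adj x d := by
  -- The three unwanted cases put a house (`x` adjacent to `c` and `d`), a `C₅` (only to `d`) or a
  -- `P₅` (to neither) on the five vertices.
  by_cases xc : G.Adj x c <;> by_cases xd : G.Adj x d
  · refine absurd (compl_pathGraph_five_isIndContained (a := x) (b := b) (c := d) (d := a)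
      (e := c) ?_ ?_ ?_ ?_ ?_ ?_ ?_ ?_ ?_ ?_) h2
    all_goals first | assumption | (rw [G.adj_comm]; assumption)
  · exact ⟨xc, xd⟩
  · refine absurd (cycleGraph_five_isIndContained (a := a) (b := b) (c := c) (d := d)
      (e := x) ?_ ?_ ?_ ?_ ?_ ?_ ?_ ?_ ?_ ?_) h3
    all_goals first | assumption | (rw [G.adj_comm]; assumption)
  · exact absurd (pathGraph_five_isIndContained xa ab bc cd xb xc xd ac ad bd) h1

/-- An induced path on four vertices in a graph without induced `P₅`, `C₅` and house cannot have
both ends of degree at least that of their neighbours on the path. -/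
theorem degree_lt_of_path [Fintype V] [DecidableRel G.Adj] (h1 : ¬ pathGraph 5 ⊴ G)
    (h2 : ¬ (pathGraph 5)ᶜ ⊴ G) (h3 : ¬ cycleGraph 5 ⊴ G) {a b c d : V} (ab : G.Adj a b)
    (bc : G.Adj b c) (cd : G.Adj c d) (ac : ¬ G.Adj a c) (ad : ¬ G.Adj a d) (bd : ¬ G.Adj b d)
    (hab : G.degree b ≤ G.degree a) : G.degree d < G.degree c := by
  classical
  -- By `adj_of_adj_end`, the vertices of `N(a) \ N(b)` other than `b` lie in `N(c) \ N(d)`, which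
  -- also contains `b` and `d`; so `|N(c) \ N(d)| > |N(a) \ N(b)|`. Symmetrically `|N(b) \ N(a)| >
  -- |N(d) \ N(c)|`. With `hab` and `hdc` these inequalities close into a cycle.
  by_contra! hdc
  have hX : ∀ x ∈ (G.neighborFinset a \ G.neighborFinset b).erase b, G.Adj x c ∧ ¬ G.Adj x d := by
    intro x hx
    simp only [Finset.mem_erase, Finset.mem_sdiff, mem_neighborFinset] at hx
    exact adj_of_adj_end h1 h2 h3 ab bc cd ac ad bd hx.2.1.symm fun h => hx.2.2 h.symm
  have hY : ∀ x ∈ (G.neighborFinset d \ G.neighborFinset c).erase c, G.Adj x b ∧ ¬ G.Adj x a := by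
    intro x hx
    simp only [Finset.mem_erase, Finset.mem_sdiff, mem_neighborFinset] at hx
    exact adj_of_adj_end h1 h2 h3 cd.symm bc.symm ab.symm (fun h => bd h.symm)
      (fun h => ad h.symm) (fun h => ac h.symm) hx.2.1.symm fun h => hx.2.2 h.symm
  have hca := Finset.card_sdiff_add_card_inter (G.neighborFinset a) (G.neighborFinset b)
  have hcb := Finset.card_sdiff_add_card_inter (G.neighborFinset b) (G.neighborFinset a)
  have hcc := Finset.card_sdiff_add_card_inter (G.neighborFinset c) (G.neighborFinset d)
  have hcd := Finset.card_sdiff_add_card_inter (G.neighborFinset d) (G.neighborFinset c)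
  rw [Finset.inter_comm] at hcb hcd
  simp only [card_neighborFinset_eq_degree] at hca hcb hcc hcd
  have e1 := Finset.card_erase_of_mem (s := G.neighborFinset a \ G.neighborFinset b) (a := b)
    (by simp [ab])
  have e2 := Finset.card_erase_of_mem (s := G.neighborFinset d \ G.neighborFinset c) (a := c)
    (by simp [cd.symm])
  have s1 : insert a (insert c ((G.neighborFinset d \ G.neighborFinset c).erase c)) ⊆
      G.neighborFinset b \ G.neighborFinset a := by
    intro x hx
    simp only [Finset.mem_insert] at hx
    rcases hx with rfl | rfl | hx
    · simp [ab.symm]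
    · simp [bc, ac]
    · have := hY x hx
      simpa [this.1.symm] using fun h : G.Adj a x => this.2 h.symm
  have s2 : insert d (insert b ((G.neighborFinset a \ G.neighborFinset b).erase b)) ⊆
      G.neighborFinset c \ G.neighborFinset d := by
    intro x hx
    simp only [Finset.mem_insert] at hx
    rcases hx with rfl | rfl | hx
    · simp [cd]
    · simpa [bc.symm] using fun h : G.Adj d x => bd h.symm
    · have := hX x hx
      simpa [this.1.symm] using fun h : G.Adj d x => this.2 h.symm
  have c1 := Finset.card_le_card s1
  have c2 := Finset.card_le_card s2
  rw [Finset.card_insert_of_notMem, Finset.card_insert_of_notMem (Finset.notMem_erase _ _)] at c1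
  · rw [Finset.card_insert_of_notMem, Finset.card_insert_of_notMem (Finset.notMem_erase _ _)] at c2
    · have p1 : 0 < (G.neighborFinset a \ G.neighborFinset b).card :=
        Finset.card_pos.2 ⟨b, by simp [ab]⟩
      have p2 : 0 < (G.neighborFinset d \ G.neighborFinset c).card :=
        Finset.card_pos.2 ⟨c, by simp [cd.symm]⟩
      omega
    · simp only [Finset.mem_insert, Finset.mem_erase, Finset.mem_sdiff, mem_neighborFinset]
      rintro (rfl | ⟨-, h, -⟩)
      · exact ad ab
      · exact ad h
  · simp only [Finset.mem_insert, Finset.mem_erase, Finset.mem_sdiff, mem_neighborFinset]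
    rintro (rfl | ⟨-, h, -⟩)
    · exact ad cd
    · exact ad h.symm

/-- A linear order of the vertices is perfect if no induced path `a b c d` has `a < b` and
`d < c`. -/
def IsPerfectOrder [LinearOrder V] (G : SimpleGraph V) : Prop :=
  ∀ a b c d, G.Adj a b → G.Adj b c → G.Adj c d → ¬ G.Adj a c → ¬ G.Adj a d → ¬ G.Adj b d →
    a < b → ¬ d < c

/-- If every vertex of a nonempty clique `C` has a smaller neighbour in a stable set, then one of
these neighbours is adjacent to all of `C`. -/
theorem IsPerfectOrder.exists_complete [LinearOrder V] (hG : G.IsPerfectOrder) (p : V → V)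
    {C : Finset V} (hne : C.Nonempty) (hC : ∀ u ∈ C, ∀ v ∈ C, u ≠ v → G.Adj u v)
    (hp : ∀ v ∈ C, G.Adj (p v) v ∧ p v < v) (hS : ∀ u ∈ C, ∀ v ∈ C, ¬ G.Adj (p u) (p v)) :
    ∃ u ∈ C, ∀ v ∈ C, G.Adj (p u) v := by
  classical
  induction C using Finset.strongInduction with
  | H C ih =>
    -- Take the smallest chosen neighbour `p u`. If it misses part of `C`, induction on that part
    -- gives some `p v` complete to it, and `p v` turns out to be complete to all of `C`.
    obtain ⟨u, hu, hmin⟩ := C.exists_min_image p hne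
    by_cases hall : ∀ v ∈ C, G.Adj (p u) v
    · exact ⟨u, hu, hall⟩
    push Not at hall
    obtain ⟨v₁, hv₁, hn₁⟩ := hall
    obtain ⟨v, hv, hcomp⟩ := ih (C.filter fun v => ¬ G.Adj (p u) v)
      (Finset.filter_ssubset.2 ⟨u, hu, by simpa using (hp u hu).1⟩)
      ⟨v₁, Finset.mem_filter.2 ⟨hv₁, hn₁⟩⟩
      (fun a ha b hb => hC a (Finset.mem_filter.1 ha).1 b (Finset.mem_filter.1 hb).1)
      (fun a ha => hp a (Finset.mem_filter.1 ha).1)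
      (fun a ha b hb => hS a (Finset.mem_filter.1 ha).1 b (Finset.mem_filter.1 hb).1)
    obtain ⟨hvC, hvn⟩ := Finset.mem_filter.1 hv
    refine ⟨v, hvC, fun w hw => ?_⟩
    by_contra hvw
    have huw : G.Adj (p u) w := by
      by_contra h
      exact hvw (hcomp w (Finset.mem_filter.2 ⟨hw, h⟩))
    have hne : v ≠ w := by
      rintro rfl
      exact hvn huw
    -- If `p v` missed `w`, then `p v, v, w, p u` would be an induced path with `p v < v` and `p u ≤
    -- p w < w`, which a perfect order forbids.
    exact hG (p v) v w (p u) (hp v hvC).1 (hC v hvC w hw hne) huw.symm hvw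
      (hS v hvC u hu) (fun h => hvn h.symm) (hp v hvC).2
      ((hmin w hw).trans_lt (hp w hw).2)

/-- The greedy colouring with respect to a well-founded linear order. -/
noncomputable def greedy [LinearOrder V] [WellFoundedLT V] (G : SimpleGraph V) : V → ℕ :=
  wellFounded_lt.fix fun v ih => sInf {c | ∀ u, (h : u < v) → G.Adj u v → ih u h ≠ c}

theorem greedy_spec [LinearOrder V] [Finite V] (v : V) :
    (∀ u < v, G.Adj u v → G.greedy u ≠ G.greedy v) ∧
      ∀ c < G.greedy v, ∃ u < v, G.Adj u v ∧ G.greedy u = c := by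
  have hne : {c | ∀ u, u < v → G.Adj u v → greedy G u ≠ c}.Nonempty := by
    -- Only finitely many colours are used at all, so the set whose `sInf` defines the colour is
    -- nonempty and the infimum is attained.
    obtain ⟨c, hc⟩ := (Set.finite_range G.greedy).exists_notMem
    exact ⟨c, fun u _ _ h => hc ⟨u, h⟩⟩
  have hdef : G.greedy v = sInf {c | ∀ u, u < v → G.Adj u v → greedy G u ≠ c} := by
    rw [greedy, WellFounded.fix_eq]
  constructor
  · rw [hdef]
    exact Nat.sInf_mem hne
  · intro c hc
    rw [hdef] at hc
    have := Nat.notMem_of_lt_sInf hc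
    simpa using this

/-- A graph with a perfect order has a colouring and a clique of the same size. -/
theorem IsPerfectOrder.exists_clique [LinearOrder V] [Finite V] (hG : G.IsPerfectOrder) :
    ∃ (n : ℕ) (C : Finset V), G.ColOn Set.univ n ∧ C.card = n ∧
      ∀ u ∈ C, ∀ v ∈ C, u ≠ v → G.Adj u v := by
  classical
  have hproper : ∀ u v, G.Adj u v → G.greedy u ≠ G.greedy v := by
    intro u v h
    rcases lt_trichotomy u v with hlt | rfl | hlt
    · exact (greedy_spec v).1 u hlt h
    · exact absurd rfl h.ne
    · exact ((greedy_spec u).1 v hlt h.symm).symm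
  cases isEmpty_or_nonempty V
  · exact ⟨0, ∅, ⟨G.greedy, fun v => isEmptyElim v, fun v => isEmptyElim v⟩, rfl, by simp⟩
  obtain ⟨v, hv⟩ := Finite.exists_max G.greedy
  -- The clique grows downwards from a vertex of largest colour, one colour at a time. Every member
  -- has an earlier neighbour in the next lower colour class, which is stable, so `exists_complete`
  -- supplies the next member.
  have key : ∀ j ≤ G.greedy v, ∃ C : Finset V, C.Nonempty ∧ C.card = j + 1 ∧
      (∀ u ∈ C, ∀ w ∈ C, u ≠ w → G.Adj u w) ∧ ∀ u ∈ C, G.greedy v - j ≤ G.greedy u := by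
    intro j
    induction j with
    | zero => exact fun _ => ⟨{v}, by simp, by simp, by simp, by simp⟩
    | succ j ih =>
      intro hj
      obtain ⟨C, hne, hcard, hC, hcol⟩ := ih (by omega)
      have hex : ∀ u, ∃ w, u ∈ C → w < u ∧ G.Adj w u ∧ G.greedy w = G.greedy v - (j + 1) := by
        intro u
        by_cases hu : u ∈ C
        · have := hcol u hu
          obtain ⟨w, hw⟩ := (greedy_spec (G := G) u).2 (G.greedy v - (j + 1)) (by omega)
          exact ⟨w, fun _ => hw⟩
        · exact ⟨u, fun h => absurd h hu⟩
      choose p hp using hex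
      obtain ⟨u, hu, hcomp⟩ := hG.exists_complete p hne hC
        (fun w hw => ⟨(hp w hw).2.1, (hp w hw).1⟩)
        (fun a ha b hb h => hproper _ _ h ((hp a ha).2.2.trans (hp b hb).2.2.symm))
      have hnot : p u ∉ C := fun h => (hcomp _ h).ne rfl
      refine ⟨insert (p u) C, by simp, by rw [Finset.card_insert_of_notMem hnot, hcard], ?_, ?_⟩
      · intro a ha b hb hab
        rcases Finset.mem_insert.1 ha with rfl | ha <;> rcases Finset.mem_insert.1 hb with rfl | hb
        · exact absurd rfl hab
        · exact hcomp b hb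
        · exact (hcomp a ha).symm
        · exact hC a ha b hb hab
      · intro a ha
        rcases Finset.mem_insert.1 ha with rfl | ha
        · exact (hp u hu).2.2.ge
        · have := hcol a ha
          omega
  obtain ⟨C, -, hcard, hC, -⟩ := key _ le_rfl
  exact ⟨G.greedy v + 1, C, ⟨G.greedy, fun u _ => Nat.lt_succ_of_le (hv u),
    fun a _ b _ => hproper a b⟩, hcard, hC⟩

/-- Graphs without induced `P₅`, house and `C₅` have a colouring and a clique of the same size. -/
theorem exists_clique_of_free [Finite V] (h1 : ¬ pathGraph 5 ⊴ G) (h2 : ¬ (pathGraph 5)ᶜ ⊴ G)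
    (h3 : ¬ cycleGraph 5 ⊴ G) : ∃ (n : ℕ) (C : Finset V), G.ColOn Set.univ n ∧ C.card = n ∧
      ∀ u ∈ C, ∀ v ∈ C, u ≠ v → G.Adj u v := by
  classical
  have := Fintype.ofFinite V
  -- Vertices are ordered by decreasing degree, with ties broken by an arbitrary enumeration.
  let r : V → ℕᵒᵈ ×ₗ Fin (Fintype.card V) := fun v =>
    toLex (OrderDual.toDual (G.degree v), Fintype.equivFin V v)
  have hr : Function.Injective r := by
    intro u v h
    have := congrArg (fun x => (ofLex x).2) h
    simpa [r] using this
  let _ : LinearOrder V := LinearOrder.lift' r hr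
  have hlt : ∀ u v : V, u < v → G.degree v ≤ G.degree u := by
    intro u v h
    have h' : r u < r v := h
    rcases Prod.Lex.lt_iff.1 h' with h | h
    · exact (OrderDual.toDual_lt_toDual.1 h).le
    · exact (OrderDual.toDual_inj.1 h.1).ge
  refine IsPerfectOrder.exists_clique (G := G) ?_
  intro a b c d ab bc cd ac ad bd hab hdc
  exact absurd (degree_lt_of_path h1 h2 h3 ab bc cd ac ad bd (hlt _ _ hab))
    (not_lt.2 (hlt _ _ hdc))

/-- The graph obtained from `Q` by replacing each vertex `i` by a clique on `w i` vertices. -/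
def cliqueBlowup (Q : SimpleGraph ι) (w : ι → ℕ) : SimpleGraph (Σ i, Fin (w i)) where
  Adj x y := x ≠ y ∧ (x.1 = y.1 ∨ Q.Adj x.1 y.1)
  symm := ⟨fun _ _ h => ⟨h.1.symm, h.2.imp Eq.symm Adj.symm⟩⟩
  loopless := ⟨fun _ h => h.1 rfl⟩

/-- Blowing up vertices to cliques creates no induced copy of a graph without true twins. -/
theorem isIndContained_of_cliqueBlowup {κ : Type*} {H : SimpleGraph κ} {Q : SimpleGraph ι}
    {w : ι → ℕ} (hH : ∀ i j, H.Adj i j → ∃ k, k ≠ i ∧ k ≠ j ∧ ¬ (H.Adj i k ↔ H.Adj j k))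
    (h : H ⊴ Q.cliqueBlowup w) : H ⊴ Q := by
  obtain ⟨f⟩ := h
  have hadj : ∀ i j, H.Adj i j ↔ f i ≠ f j ∧ ((f i).1 = (f j).1 ∨ Q.Adj (f i).1 (f j).1) :=
    fun i j => f.map_rel_iff.symm
  have hinj : Function.Injective fun i => (f i).1 := by
    intro i j (hij : (f i).1 = (f j).1)
    by_contra hne
    obtain ⟨k, hki, hkj, hk⟩ := hH i j ((hadj i j).2 ⟨f.injective.ne hne, Or.inl hij⟩)
    refine hk ?_
    rw [hadj, hadj, hij]
    simp [f.injective.ne hki.symm, f.injective.ne hkj.symm]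
  refine ⟨⟨⟨_, hinj⟩, fun {i j} => ?_⟩⟩
  change Q.Adj (f i).1 (f j).1 ↔ _
  rw [hadj]
  by_cases hij : i = j
  · subst hij
    simp
  · have h1 : f i ≠ f j := f.injective.ne hij
    have h2 : (f i).1 ≠ (f j).1 := hinj.ne hij
    simp [h1, h2]

/-- The weighted form of perfection for graphs without induced `P₅`, house and `C₅`. -/
theorem exists_weighted_clique [Finite ι] {Q : SimpleGraph ι} (h1 : ¬ pathGraph 5 ⊴ Q)
    (h2 : ¬ (pathGraph 5)ᶜ ⊴ Q) (h3 : ¬ cycleGraph 5 ⊴ Q) (w : ι → ℕ) :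
    ∃ (n : ℕ) (C : Finset ι) (A : ι → Finset ℕ), (∀ u ∈ C, ∀ v ∈ C, u ≠ v → Q.Adj u v) ∧
      n ≤ ∑ i ∈ C, w i ∧ (∀ i, A i ⊆ Finset.range n) ∧ (∀ i, (A i).card = w i) ∧
      ∀ i j, Q.Adj i j → Disjoint (A i) (A j) := by
  classical
  obtain ⟨n, C, ⟨c, hcn, hc⟩, hcard, hC⟩ := exists_clique_of_free (G := Q.cliqueBlowup w)
    (fun h => h1 (isIndContained_of_cliqueBlowup (by decide) h))
    (fun h => h2 (isIndContained_of_cliqueBlowup (by decide) h))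
    (fun h => h3 (isIndContained_of_cliqueBlowup (by decide) h))
  refine ⟨n, C.image Sigma.fst, fun i => Finset.univ.image fun a => c ⟨i, a⟩, ?_, ?_, ?_, ?_, ?_⟩
  · intro u hu v hv huv
    obtain ⟨x, hx, rfl⟩ := Finset.mem_image.1 hu
    obtain ⟨y, hy, rfl⟩ := Finset.mem_image.1 hv
    exact (hC x hx y hy fun e => huv (congrArg _ e)).2.resolve_left huv
  -- The clique of the blowup may use only some of the copies of a vertex, hence an inequality; it
  -- is the direction that is needed.
  · have hsub : C ⊆ (C.image Sigma.fst).sigma fun _ => Finset.univ := by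
      intro x hx
      simpa using ⟨x.2, hx⟩
    have := Finset.card_le_card hsub
    rw [Finset.card_sigma] at this
    simpa [← hcard] using this
  · intro i a ha
    obtain ⟨b, -, rfl⟩ := Finset.mem_image.1 ha
    exact Finset.mem_range.2 (hcn _ trivial)
  · intro i
    rw [Finset.card_image_of_injective, Finset.card_univ, Fintype.card_fin]
    intro a b hab
    by_contra hne
    exact hc ⟨i, a⟩ trivial ⟨i, b⟩ trivial ⟨by simpa using hne, Or.inl rfl⟩ hab
  · intro i j hij
    rw [Finset.disjoint_left]
    intro a ha hb
    obtain ⟨x, -, rfl⟩ := Finset.mem_image.1 ha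
    obtain ⟨y, -, hy⟩ := Finset.mem_image.1 hb
    refine hc ⟨i, x⟩ trivial ⟨j, y⟩ trivial ⟨fun e => hij.ne (congrArg Sigma.fst e), Or.inr hij⟩
      hy.symm

end SimpleGraph

/-! ### Decomposition into joins and buoys -/

namespace SimpleGraph

variable {V ι : Type*} {G : SimpleGraph V} {Q : SimpleGraph ι} {π : V → ι} {m : ℕ}

theorem IsSubst.isIndContained (h : IsSubst G Q π) (hπ : Function.Surjective π) : Q ⊴ G := by
  obtain ⟨s, hs⟩ := hπ.hasRightInverse
  refine ⟨⟨⟨s, hs.injective⟩, fun {i j} => ?_⟩⟩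
  change G.Adj (s i) (s j) ↔ _
  by_cases hij : i = j
  · subst hij
    simp
  · rw [h _ _ (by rwa [hs, hs]), hs, hs]

/-- A critical graph without induced `P₅` and house that is obtained by substitution into a
`C₅`-free graph is obtained by substitution into a complete graph. -/
theorem IsSubst.adj_of_critOn [Finite V] [Finite ι] (h : IsSubst G Q π)
    (hπ : Function.Surjective π) (hG : G.CritOn Set.univ m) (h1 : ¬ pathGraph 5 ⊴ G)
    (h2 : ¬ (pathGraph 5)ᶜ ⊴ G) (h3 : ¬ cycleGraph 5 ⊴ Q) {i j : ι} (hij : i ≠ j) :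
    Q.Adj i j := by
  classical
  have hQ := h.isIndContained hπ
  have hfib : ∀ i, ∃ w, G.CritOn (π ⁻¹' {i}) w := fun i => by
    obtain ⟨v, hv⟩ := hπ i
    exact h.exists_critOn_fiber hG ⟨v, hv⟩
  choose w hw using hfib
  obtain ⟨n, C, A, hC, hn, hA, hcard, hd⟩ := exists_weighted_clique
    (fun e => h1 (e.trans hQ)) (fun e => h2 (e.trans hQ)) h3 fun i => w i + 1
  have hmn := hG.lt_of_colOn (h.colOn_univ_of _ (fun i => (hw i).colOn) A hA hd
    fun i => (hcard i).ge)
  -- The clique `C` has weight at least `n ≥ m + 1`. If it avoided `i`, deleting a vertex of the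
  -- fibre over `i` would leave this weight intact, yet the result is `m`-colourable.
  have hall : ∀ i, i ∈ C := by
    intro i
    by_contra hi
    obtain ⟨v, rfl⟩ := hπ i
    obtain ⟨A, hA, hd, hc, -⟩ := h.exists_of_colOn_diff hw (hG.2 v trivial)
    have hsum : ∑ i ∈ C, (w i + 1) ≤ m := by
      calc ∑ i ∈ C, (w i + 1) ≤ ∑ i ∈ C, (A i).card :=
            Finset.sum_le_sum fun i hiC => hc i fun e => hi (e ▸ hiC)
        _ = (C.biUnion A).card := by
            rw [Finset.card_biUnion]
            exact fun a ha b hb hab => hd a b (hC a ha b hb hab)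
        _ ≤ m := by
            simpa using Finset.card_le_card (Finset.biUnion_subset.2 fun i _ => hA i)
    omega
  exact hC i (hall i) j (hall j) hij

/-- How a vertex can be attached to an induced `C₅` in a graph without induced `P₅` and house. -/
theorem attach_cycle (h1 : ¬ pathGraph 5 ⊴ Q) (h2 : ¬ (pathGraph 5)ᶜ ⊴ Q) {t : Fin 5 → ι}
    (ht : ∀ i j, Q.Adj (t i) (t j) ↔ (cycleGraph 5).Adj i j) (x : ι) :
    (∀ i, ¬ Q.Adj x (t i)) ∨ (∀ i, Q.Adj x (t i)) ∨ ∃ i, Q.Adj x (t (i + 1)) ∧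
      Q.Adj x (t (i + 4)) ∧ ¬ Q.Adj x (t (i + 2)) ∧ ¬ Q.Adj x (t (i + 3)) := by
  classical
  have r1 : ∀ i, ¬ (Q.Adj x (t i) ∧ ¬ Q.Adj x (t (i + 1)) ∧ ¬ Q.Adj x (t (i + 2)) ∧
      ¬ Q.Adj x (t (i + 3))) := by
    rintro i ⟨a, b, c, d⟩
    refine h1 (pathGraph_five_isIndContained a ?_ ?_ ?_ b c d ?_ ?_ ?_) <;>
      rw [ht] <;> clear a b c d <;> revert i <;> decide
  have r2 : ∀ i, ¬ (¬ Q.Adj x (t i) ∧ Q.Adj x (t (i + 2)) ∧ Q.Adj x (t (i + 4)) ∧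
      Q.Adj x (t (i + 1))) := by
    rintro i ⟨a, b, c, d⟩
    refine h2 (compl_pathGraph_five_isIndContained a ?_ ?_ ?_ b c d ?_ ?_ ?_) <;>
      rw [ht] <;> clear a b c d <;> revert i <;> decide
  -- A check of all 32 neighbourhoods on the cycle. In the last alternative adjacency of `x` to `t
  -- i` itself is left open: `x` can replace `t i` in the cycle.
  have key : ∀ s : Fin 5 → Bool, (∀ i, ¬ (s i ∧ ¬ s (i + 1) ∧ ¬ s (i + 2) ∧ ¬ s (i + 3))) →
      (∀ i, ¬ (¬ s i ∧ s (i + 2) ∧ s (i + 4) ∧ s (i + 1))) →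
      (∀ i, ¬ s i) ∨ (∀ i, s i) ∨ ∃ i, s (i + 1) ∧ s (i + 4) ∧ ¬ s (i + 2) ∧ ¬ s (i + 3) := by
    decide
  simpa using key (fun i => decide (Q.Adj x (t i))) (by simpa using r1) (by simpa using r2)

/-- A partial map `c` to the five-cycle that exhibits its domain as a buoy. -/
def IsPartialBuoy (Q : SimpleGraph ι) (c : ι → Option (Fin 5)) : Prop :=
  (∀ i, ∃ v, c v = some i) ∧ ∀ u v i j, c u = some i → c v = some j → i ≠ j →
    (Q.Adj u v ↔ (cycleGraph 5).Adj i j)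

theorem exists_isPartialBuoy (h : cycleGraph 5 ⊴ Q) : ∃ c, Q.IsPartialBuoy c := by
  obtain ⟨f⟩ := h
  have hf := Function.Injective.isPartialInv f.injective
  refine ⟨Function.partialInv f, fun i => ⟨f i, (hf _ _).2 rfl⟩, ?_⟩
  intro u v i j hu hv _
  rw [← (hf _ _).1 hu, ← (hf _ _).1 hv]
  exact f.map_rel_iff

theorem IsPartialBuoy.transversal {c : ι → Option (Fin 5)} (hc : Q.IsPartialBuoy c)
    {t : Fin 5 → ι} (ht : ∀ i, c (t i) = some i) (i j : Fin 5) :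
    Q.Adj (t i) (t j) ↔ (cycleGraph 5).Adj i j := by
  by_cases hij : i = j
  · subst hij
    simp
  · exact hc.2 _ _ _ _ (ht i) (ht j) hij

/-- A vertex outside a buoy that looks like a twin of the vertex `i` of some transversal can be
added to the bag `i`. -/
theorem IsPartialBuoy.update (h1 : ¬ pathGraph 5 ⊴ Q) (h2 : ¬ (pathGraph 5)ᶜ ⊴ Q)
    [DecidableEq ι] {c : ι → Option (Fin 5)} (hc : Q.IsPartialBuoy c) {t : Fin 5 → ι}
    (ht : ∀ i, c (t i) = some i) {x : ι} (hx : c x = none) {i : Fin 5}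
    (hi : Q.Adj x (t (i + 1)) ∧ Q.Adj x (t (i + 4)) ∧ ¬ Q.Adj x (t (i + 2)) ∧
      ¬ Q.Adj x (t (i + 3))) : Q.IsPartialBuoy (Function.update c x (some i)) := by
  classical
  -- If `x` behaves like vertex `i` towards two of the three vertices other than `i` and `j`, and
  -- the third too, the alternatives of `attach_cycle` force the same towards `j`. So any vertex of
  -- bag `j` may be exchanged for `t j`.
  have key : ∀ i : Fin 5, ∀ s : Fin 5 → Bool, (∀ i, ¬ s i) ∨ (∀ i, s i) ∨
        (∃ i, s (i + 1) ∧ s (i + 4) ∧ ¬ s (i + 2) ∧ ¬ s (i + 3)) →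
      ∀ j, j ≠ i → (∀ l, l ≠ i → l ≠ j → (s l = true ↔ (cycleGraph 5).Adj i l)) →
      (s j = true ↔ (cycleGraph 5).Adj i j) := by
    decide
  have ht' : ∀ l, l ≠ i → (Q.Adj x (t l) ↔ (cycleGraph 5).Adj i l) := by
    obtain ⟨a, b, c, d⟩ := hi
    intro l hl
    have hl' : l = i + 1 ∨ l = i + 4 ∨ l = i + 2 ∨ l = i + 3 := by
      clear a b c d
      revert i l
      decide
    have hadj : ∀ i : Fin 5, (cycleGraph 5).Adj i (i + 1) ∧ (cycleGraph 5).Adj i (i + 4) ∧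
      ¬ (cycleGraph 5).Adj i (i + 2) ∧ ¬ (cycleGraph 5).Adj i (i + 3) := by decide
    obtain ⟨a', b', c', d'⟩ := hadj i
    rcases hl' with rfl | rfl | rfl | rfl
    · exact iff_of_true a a'
    · exact iff_of_true b b'
    · exact iff_of_false c c'
    · exact iff_of_false d d'
  have hall : ∀ v j, c v = some j → j ≠ i → (Q.Adj x v ↔ (cycleGraph 5).Adj i j) := by
    intro v j hv hj
    have hu : ∀ l, c (Function.update t j v l) = some l := by
      intro l
      by_cases hl : l = j
      · subst hl
        simpa using hv
      · simpa [hl] using ht l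
    have hatt := attach_cycle h1 h2 (hc.transversal hu) x
    have := key i (fun l => decide (Q.Adj x (Function.update t j v l))) (by simpa using hatt) j hj
      (fun l hl hlj => by simpa [hlj] using ht' l hl)
    simpa using this
  refine ⟨fun j => ⟨t j, ?_⟩, ?_⟩
  · rw [Function.update_of_ne, ht]
    rintro rfl
    simp [ht] at hx
  · intro u v a b hu hv hab
    by_cases hux : u = x <;> by_cases hvx : v = x
    · subst hux hvx
      rw [hu] at hv
      exact absurd (Option.some.inj hv) hab
    · subst hux
      rw [Function.update_self] at hu
      rw [Function.update_of_ne hvx] at hv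
      obtain rfl := Option.some.inj hu
      exact hall v b hv hab.symm
    · subst hvx
      rw [Function.update_self] at hv
      rw [Function.update_of_ne hux] at hu
      obtain rfl := Option.some.inj hv
      rw [Q.adj_comm, (cycleGraph 5).adj_comm]
      exact hall u a hu hab
    · rw [Function.update_of_ne hux] at hu
      rw [Function.update_of_ne hvx] at hv
      exact hc.2 u v a b hu hv hab

/-- A maximal buoy is a homogeneous set. -/
theorem exists_homogeneous_buoy [Finite ι] (h1 : ¬ pathGraph 5 ⊴ Q) (h2 : ¬ (pathGraph 5)ᶜ ⊴ Q)
    (h3 : cycleGraph 5 ⊴ Q) : ∃ c, Q.IsPartialBuoy c ∧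
      ∀ x u v, c x = none → c u ≠ none → c v ≠ none → (Q.Adj x u ↔ Q.Adj x v) := by
  classical
  have := Fintype.ofFinite ι
  obtain ⟨c₀, hc₀⟩ := exists_isPartialBuoy h3
  have : Nonempty {c // Q.IsPartialBuoy c} := ⟨⟨c₀, hc₀⟩⟩
  -- The buoy is chosen with the most vertices, so the last alternative of `attach_cycle` never
  -- occurs for an outside vertex: it could be added.
  obtain ⟨⟨c, hc⟩, hmax⟩ := Finite.exists_max fun c : {c // Q.IsPartialBuoy c} =>
    (Finset.univ.filter fun v => c.1 v ≠ none).card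
  refine ⟨c, hc, ?_⟩
  have hdich : ∀ x, c x = none → ∀ t : Fin 5 → ι, (∀ i, c (t i) = some i) →
      (∀ i, ¬ Q.Adj x (t i)) ∨ (∀ i, Q.Adj x (t i)) := by
    intro x hx t ht
    rcases attach_cycle h1 h2 (hc.transversal ht) x with h | h | ⟨i, hi⟩
    · exact Or.inl h
    · exact Or.inr h
    · have hle := hmax ⟨_, hc.update h1 h2 ht hx hi⟩
      refine absurd hle (not_le.2 (Finset.card_lt_card ?_))
      refine (Finset.ssubset_iff_of_subset ?_).2 ⟨x, by simp, by simp [hx]⟩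
      intro v hv
      simp only [Finset.mem_filter, Finset.mem_univ, true_and] at hv ⊢
      by_cases hvx : v = x
      · simp [hvx]
      · simpa [hvx] using hv
  choose t ht using hc.1
  -- Exchanging one vertex of a transversal for `u` keeps the other four, so the answers "adjacent
  -- to all" and "adjacent to none" agree for the two transversals.
  have main : ∀ x u, c x = none → c u ≠ none → (Q.Adj x u ↔ Q.Adj x (t 0)) := by
    intro x u hx hu
    obtain ⟨j, hj⟩ := Option.ne_none_iff_exists'.1 hu
    have hu' : ∀ l, c (Function.update t j u l) = some l := by
      intro l
      by_cases hl : l = j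
      · subst hl
        simpa using hj
      · simpa [hl] using ht l
    have hne : j + 1 ≠ j := (by decide : ∀ j : Fin 5, j + 1 ≠ j) j
    have e1 : Function.update t j u j = u := by simp
    have e2 : Function.update t j u (j + 1) = t (j + 1) := by simp [hne]
    rcases hdich x hx t ht with h | h <;> rcases hdich x hx _ hu' with h' | h'
    · exact iff_of_false (e1 ▸ h' j) (h 0)
    · exact absurd (e2 ▸ h' (j + 1)) (h (j + 1))
    · exact absurd (h (j + 1)) (e2 ▸ h' (j + 1))
    · exact iff_of_true (e1 ▸ h' j) (h 0)
  intro x u v hx hu hv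
  rw [main x u hx hu, main x v hx hv]

/-- A critical graph without induced `P₅` and house which is a substitution into a graph on at
least two vertices is a join or a buoy. -/
theorem IsSubst.join_or_buoy [Finite V] (hG : G.CritOn Set.univ m) (h1 : ¬ pathGraph 5 ⊴ G)
    (h2 : ¬ (pathGraph 5)ᶜ ⊴ G) (n : ℕ) : ∀ {ι : Type*} [Finite ι] [Nontrivial ι]
      {Q : SimpleGraph ι} {π : V → ι}, IsSubst G Q π → Function.Surjective π → Nat.card ι = n →
      (∃ π : V → Bool, Function.Surjective π ∧ IsSubst G ⊤ π) ∨
        ∃ π : V → Fin 5, Function.Surjective π ∧ IsSubst G (cycleGraph 5) π := by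
  classical
  induction n using Nat.strong_induction_on with
  | _ n ih =>
  intro ι _ _ Q π h hπ hn
  have hQ := h.isIndContained hπ
  by_cases h3 : cycleGraph 5 ⊴ Q
  · obtain ⟨c, hc, hhom⟩ := exists_homogeneous_buoy (fun e => h1 (e.trans hQ))
      (fun e => h2 (e.trans hQ)) h3
    by_cases hall : ∀ x, c x ≠ none
    · right
      choose p hp using fun x => Option.ne_none_iff_exists'.1 (hall x)
      have hsub : IsSubst Q (cycleGraph 5) p := fun u v huv => hc.2 u v _ _ (hp u) (hp v) huv
      refine ⟨p ∘ π, Function.Surjective.comp (fun i => ?_) hπ, h.comp hsub⟩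
      obtain ⟨v, hv⟩ := hc.1 i
      exact ⟨v, Option.some.inj ((hp v).symm.trans hv)⟩
    · push Not at hall
      obtain ⟨x₀, hx₀⟩ := hall
      obtain ⟨t₀, ht₀⟩ := hc.1 0
      obtain ⟨t₁, ht₁⟩ := hc.1 1
      -- The buoy is contracted to the vertex `none`, represented by `t₀`. The vertex `x₀` outside
      -- keeps the quotient nontrivial, and `t₁`, no longer represented, makes it smaller.
      let rep : Option {x // c x = none} → ι := fun y => y.elim t₀ Subtype.val
      let ρ : ι → Option {x // c x = none} := fun x =>
        if hx : c x = none then some ⟨x, hx⟩ else none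
      have hρrep : ∀ y, ρ (rep y) = y := by
        rintro (_ | ⟨y, hy⟩)
        · simp [ρ, rep, ht₀]
        · simp [ρ, rep, hy]
      have hsub : IsSubst Q (Q.comap rep) ρ := by
        intro u v huv
        rw [comap_adj]
        by_cases hu : c u = none <;> by_cases hv : c v = none
        · simp [ρ, rep, hu, hv]
        · simpa [ρ, rep, hu, hv] using hhom u v t₀ hu hv (by simp [ht₀])
        · rw [Q.adj_comm, Q.adj_comm (rep _)]
          simpa [ρ, rep, hu, hv] using hhom v u t₀ hv hu (by simp [ht₀])
        · simp [ρ, hu, hv] at huv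
      have : Nontrivial (Option {x // c x = none}) := ⟨⟨none, some ⟨x₀, hx₀⟩, by simp⟩⟩
      have hlt : Nat.card (Option {x // c x = none}) < n := by
        have := Fintype.ofFinite ι
        rw [← hn, Nat.card_eq_fintype_card, Nat.card_eq_fintype_card]
        refine Fintype.card_lt_of_injective_of_notMem rep
          (Function.LeftInverse.injective hρrep) (b := t₁) ?_
        rintro ⟨_ | ⟨y, hy⟩, rfl⟩
        · rw [show rep none = t₀ from rfl, ht₀] at ht₁
          exact absurd (Option.some.inj ht₁) (by decide)
        · rw [show rep (some ⟨y, hy⟩) = y from rfl, hy] at ht₁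
          cases ht₁
      exact ih _ hlt (h.comp hsub)
        (Function.Surjective.comp (Function.RightInverse.surjective hρrep) hπ) rfl
  · left
    -- The quotient is complete, so splitting off any one vertex `i₀` gives a join.
    obtain ⟨i₀, i₁, hne⟩ := exists_pair_ne ι
    have hsub : IsSubst Q (⊤ : SimpleGraph Bool) fun i => decide (i = i₀) := by
      intro u v huv
      refine iff_of_true (h.adj_of_critOn hπ hG h1 h2 h3 fun e => huv (by rw [e])) huv
    refine ⟨_, Function.Surjective.comp (fun b => ?_) hπ, h.comp hsub⟩
    cases b
    · exact ⟨i₁, by simpa using hne.symm⟩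
    · exact ⟨i₀, by simp⟩

/-- The induction starts at the trivial substitution of `G` into itself; `0 < m` ensures that `G`
has at least two vertices. -/
theorem CritOn.join_or_buoy [Finite V] (hG : G.CritOn Set.univ m) (hm : 0 < m)
    (h1 : ¬ pathGraph 5 ⊴ G) (h2 : ¬ (pathGraph 5)ᶜ ⊴ G) :
    (∃ π : V → Bool, Function.Surjective π ∧ IsSubst G ⊤ π) ∨
      ∃ π : V → Fin 5, Function.Surjective π ∧ IsSubst G (cycleGraph 5) π := by
  have : Nontrivial V := by
    rw [← not_subsingleton_iff_nontrivial]
    intro hs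
    exact hG.1 ⟨fun _ => 0, fun _ _ => hm, fun u _ v _ h => absurd (Subsingleton.elim u v) h.ne⟩
  exact IsSubst.join_or_buoy hG h1 h2 _ (Q := G) (π := id) (fun _ _ _ => Iff.rfl)
    Function.surjective_id rfl

end SimpleGraph

/-! ### Induced subgraphs of joins and buoys -/

namespace SimpleGraph

variable {V ι : Type*} {G : SimpleGraph V} {Q : SimpleGraph ι} {π : V → ι}

theorem isIndContained_fiber_of_const {κ : Type*} {H : SimpleGraph κ} (f : H ↪g G) {i : ι}
    (hf : ∀ a, π (f a) = i) : H ⊴ G.induce (π ⁻¹' {i}) :=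
  ⟨⟨⟨fun a => ⟨f a, hf a⟩, fun _ _ h => f.injective (congrArg Subtype.val h)⟩,
    f.map_rel_iff⟩⟩

/-- A join contains an induced copy of a graph with connected complement only inside one of
its sides. -/
theorem IsSubst.isIndContained_of_top {H : SimpleGraph (Fin 5)} {π : V → Bool}
    (h : IsSubst G ⊤ π) (hH : ∀ g : Fin 5 → Bool, (∀ i j, g i ≠ g j → H.Adj i j) →
      ∀ i, g i = g 0) (hc : H ⊴ G) : ∃ i, H ⊴ G.induce (π ⁻¹' {i}) := by
  obtain ⟨f⟩ := hc
  refine ⟨π (f 0), isIndContained_fiber_of_const f ?_⟩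
  exact hH (fun i => π (f i)) fun i j hij => f.map_rel_iff.1 ((h _ _ hij).2 hij)

/-- A buoy contains an induced copy of a prime graph on five vertices other than `C₅` only
inside one of its bags. -/
theorem IsSubst.isIndContained_of_cycle {H : SimpleGraph (Fin 5)} {π : V → Fin 5}
    (h : IsSubst G (cycleGraph 5) π)
    (hH : ∀ s : Fin 5 → Bool, (∀ i j k, s i → s j → ¬ s k → (H.Adj i k ↔ H.Adj j k)) →
      (∀ i j, s i → s j → i = j) ∨ ∀ i, s i)
    [DecidableRel H.Adj] (hdeg : ∃ a, (Finset.univ.filter fun b => H.Adj a b).card ≠ 2)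
    (hc : H ⊴ G) : ∃ i, H ⊴ G.induce (π ⁻¹' {i}) := by
  obtain ⟨f⟩ := hc
  have hadj : ∀ i j, π (f i) ≠ π (f j) →
      (H.Adj i j ↔ (cycleGraph 5).Adj (π (f i)) (π (f j))) := fun i j hij =>
    f.map_rel_iff.symm.trans (h _ _ hij)
  -- A copy meeting all five bags would be a `C₅`, hence 2-regular, against `hdeg`. Otherwise two of
  -- its vertices share a bag, and the part of the copy in that bag is a homogeneous set of `H`; by
  -- `hH` it is the whole copy.
  by_cases hinj : Function.Injective fun i => π (f i)
  · obtain ⟨a, ha⟩ := hdeg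
    refine absurd ?_ ha
    have hcyc : ∀ a : Fin 5, (Finset.univ.filter fun b => (cycleGraph 5).Adj a b).card = 2 := by
      decide
    rw [← hcyc (π (f a)), ← Finset.card_image_of_injective _ hinj]
    congr 1
    ext b
    obtain ⟨b, rfl⟩ := Finite.surjective_of_injective hinj b
    rw [hinj.mem_finset_image]
    simp only [Finset.mem_filter, Finset.mem_univ, true_and]
    by_cases e : a = b
    · subst e
      simp
    · exact hadj a b (hinj.ne e)
  · simp only [Function.Injective, not_forall] at hinj
    obtain ⟨a, b, hab, hne⟩ := hinj
    refine ⟨π (f a), isIndContained_fiber_of_const f ?_⟩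
    have hmod := hH (fun i => decide (π (f i) = π (f a))) fun i j k hi hj hk => by
      simp only [decide_eq_true_eq] at hi hj hk
      rw [hadj i k (by rw [hi]; exact Ne.symm hk), hadj j k (by rw [hj]; exact Ne.symm hk), hi, hj]
    rcases hmod with h' | h'
    · exact absurd (h' a b (by simp) (by simp [hab])) hne
    · simpa using h'

end SimpleGraph

/-! ### Critical families and their decomposition up to isomorphism -/

namespace FinGraph

open SimpleGraph

theorem cls_eq_iff {G H : FinGraph} : G.cls = H.cls ↔ Nonempty (G.graph ≃g H.graph) :=
  Quotient.eq (r := isoSetoid)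

/-- The chromatic number is monotone in induced subgraphs, so it is enough to consider the deletion
of single vertices. -/
theorem isCritical_succ_iff {G : FinGraph} {m : ℕ} :
    G.IsCritical (m + 1) ↔ G.graph.CritOn Set.univ m := by
  have := G.finite
  have hle : ∀ (S : Set G.V) (n : ℕ),
      (G.graph.induce S).chromaticNumber ≤ n ↔ G.graph.ColOn S n := fun S n => by
    rw [colOn_iff_colorable, chromaticNumber_le_iff_colorable]
  have huniv : ∀ n : ℕ, G.graph.chromaticNumber ≤ n ↔ G.graph.ColOn Set.univ n := fun n => by
    rw [colOn_iff_colorable, chromaticNumber_le_iff_colorable]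
    exact ⟨fun h => h.of_hom (Embedding.induce Set.univ).toHom,
      fun h => h.of_hom (induceUnivIso G.graph).symm.toHom⟩
  have hlt : ∀ (a : ℕ∞) (n : ℕ), a ≤ (n + 1 : ℕ) → a ≠ (n + 1 : ℕ) → a ≤ n := by
    intro a n h1 h2
    have := lt_of_le_of_ne h1 h2
    push_cast at this
    exact Order.le_of_lt_add_one this
  constructor
  · rintro ⟨h1, h2⟩
    refine ⟨fun h => ?_, fun v _ => ?_⟩
    · rw [← huniv, h1] at h
      exact absurd (Nat.cast_le.1 h) (by omega)
    · rw [← hle]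
      refine hlt _ _ ?_ (h2 _ ?_)
      · rw [hle]
        exact ((huniv _).1 h1.le).mono_set (Set.subset_univ _)
      · intro h
        exact (h.ge (Set.mem_univ v)).2 rfl
  · intro h
    refine ⟨le_antisymm ((huniv _).2 h.colOn) ?_, fun S hS he => ?_⟩
    · by_contra hlt'
      have := (huniv m).1 (hlt _ _ ((huniv _).2 h.colOn) (not_le.1 hlt').ne)
      exact h.1 this
    · obtain ⟨v, hv⟩ := (Set.ne_univ_iff_exists_notMem S).1 hS
      have := (hle S m).2 ((h.2 v trivial).mono_set fun x hx => ⟨trivial, fun e => hv (e ▸ hx)⟩)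
      rw [he] at this
      exact absurd (Nat.cast_le.1 this) (by omega)

theorem isCritical_of_iso {G H : FinGraph} (e : G.graph ≃g H.graph) {m : ℕ}
    (h : G.IsCritical (m + 1)) : H.IsCritical (m + 1) := by
  rw [isCritical_succ_iff] at h ⊢
  constructor
  · rintro ⟨c, h1, h2⟩
    exact h.1 ⟨c ∘ e, fun v _ => h1 _ trivial, fun u _ v _ huv =>
      h2 _ trivial _ trivial (e.map_rel_iff.2 huv)⟩
  · intro v _
    obtain ⟨c, h1, h2⟩ := h.2 (e.symm v) trivial
    have hne : ∀ u ∈ Set.univ \ {v}, e.symm u ∈ Set.univ \ {e.symm v} := fun u hu =>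
      ⟨trivial, fun he => hu.2 (e.symm.injective he)⟩
    exact ⟨c ∘ e.symm, fun u hu => h1 _ (hne u hu), fun u hu w hw huw =>
      h2 _ (hne u hu) _ (hne w hw) (e.symm.map_rel_iff.2 huw)⟩

theorem isP5CoP5Free_of_isIndContained {G H : FinGraph} (e : H.graph ⊴ G.graph)
    (h : G.IsP5CoP5Free) : H.IsP5CoP5Free :=
  ⟨fun h' => h.1 (h'.trans e), fun h' => h.2 (h'.trans e)⟩

theorem cls_mem_critFamily {G : FinGraph} {m : ℕ} :
    G.cls ∈ critFamily (m + 1) ↔ G.graph.CritOn Set.univ m ∧ G.IsP5CoP5Free := by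
  rw [← isCritical_succ_iff]
  constructor
  · rintro ⟨H, ⟨h1, h2⟩, he⟩
    obtain ⟨e⟩ := cls_eq_iff.1 he
    exact ⟨isCritical_of_iso e h1, isP5CoP5Free_of_isIndContained ⟨e.symm.toEmbedding⟩ h2⟩
  · exact fun h => ⟨G, h, rfl⟩

/-- The subgraph induced by a set of vertices. -/
def sub (G : FinGraph) (F : Set G.V) : FinGraph :=
  ⟨F, have := G.finite; inferInstance, G.graph.induce F⟩

theorem sub_cls_mem_critFamily {G : FinGraph} {F : Set G.V} {m : ℕ} :
    (G.sub F).cls ∈ critFamily (m + 1) ↔ G.graph.CritOn F m ∧ (G.sub F).IsP5CoP5Free := by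
  rw [cls_mem_critFamily]
  exact and_congr_left fun _ => critOn_induce_univ_iff

theorem sub_isP5CoP5Free {G : FinGraph} {F : Set G.V} (h : G.IsP5CoP5Free) :
    (G.sub F).IsP5CoP5Free :=
  isP5CoP5Free_of_isIndContained (G := G) (H := G.sub F) ⟨Embedding.induce F⟩ h

theorem isP5CoP5Free_of_top {G : FinGraph} {π : G.V → Bool} (h : IsSubst G.graph ⊤ π)
    (hπ : ∀ i, (G.sub (π ⁻¹' {i})).IsP5CoP5Free) : G.IsP5CoP5Free := by
  constructor <;> intro hc
  · obtain ⟨i, hi⟩ := h.isIndContained_of_top (by decide) hc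
    exact (hπ i).1 hi
  · obtain ⟨i, hi⟩ := h.isIndContained_of_top (by decide) hc
    exact (hπ i).2 hi

theorem isP5CoP5Free_of_cycle {G : FinGraph} {π : G.V → Fin 5}
    (h : IsSubst G.graph (cycleGraph 5) π)
    (hπ : ∀ i, (G.sub (π ⁻¹' {i})).IsP5CoP5Free) : G.IsP5CoP5Free := by
  constructor <;> intro hc
  · obtain ⟨i, hi⟩ := h.isIndContained_of_cycle (by decide) (by decide) hc
    exact (hπ i).1 hi
  · obtain ⟨i, hi⟩ := h.isIndContained_of_cycle (by decide) (by decide) hc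
    exact (hπ i).2 hi

theorem join_isSubst (G H : FinGraph) : IsSubst (join G H).graph ⊤ Sum.isRight := by
  rintro (u | u) (v | v) huv <;> simp [join] at huv ⊢

theorem join_adj_inl {G H : FinGraph} {x y : G.V} :
    (join G H).graph.Adj (Sum.inl x) (Sum.inl y) ↔ G.graph.Adj x y := by
  simp [join]

theorem join_adj_inr {G H : FinGraph} {x y : H.V} :
    (join G H).graph.Adj (Sum.inr x) (Sum.inr y) ↔ H.graph.Adj x y := by
  simp [join]

theorem join_adj_inl_inr {G H : FinGraph} (x : G.V) (y : H.V) :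
    (join G H).graph.Adj (Sum.inl x) (Sum.inr y) := by
  simp [join]

theorem cls_sub_join_false (G H : FinGraph) :
    ((join G H).sub (Sum.isRight ⁻¹' {false})).cls = G.cls := by
  refine cls_eq_iff.2 ⟨RelIso.symm ⟨Equiv.ofBijective
    (fun x => ⟨Sum.inl x, rfl⟩) ⟨fun x y h => ?_, ?_⟩, ?_⟩⟩
  · exact Sum.inl.inj (congrArg Subtype.val h)
  · rintro ⟨x | x, hx⟩
    · exact ⟨x, rfl⟩
    · cases hx
  · intro x y
    exact join_adj_inl

theorem cls_sub_join_true (G H : FinGraph) :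
    ((join G H).sub (Sum.isRight ⁻¹' {true})).cls = H.cls := by
  refine cls_eq_iff.2 ⟨RelIso.symm ⟨Equiv.ofBijective
    (fun x => ⟨Sum.inr x, rfl⟩) ⟨fun x y h => ?_, ?_⟩, ?_⟩⟩
  · exact Sum.inr.inj (congrArg Subtype.val h)
  · rintro ⟨x | x, hx⟩
    · cases hx
    · exact ⟨x, rfl⟩
  · intro x y
    exact join_adj_inr

theorem buoy_adj_same {B : Fin 5 → FinGraph} {i : Fin 5} {x y : (B i).V} :
    (buoy B).graph.Adj ⟨i, x⟩ ⟨i, y⟩ ↔ (B i).graph.Adj x y := by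
  constructor
  · rintro (h | ⟨j, a, b, ha, hb, h⟩)
    · exact absurd h ((cycleGraph 5).loopless.irrefl _)
    · obtain rfl : i = j := congrArg Sigma.fst ha
      obtain rfl : x = a := by simpa using ha
      obtain rfl : y = b := by simpa using hb
      exact h
  · exact fun h => Or.inr ⟨i, x, y, rfl, rfl, h⟩

theorem buoy_isSubst (B : Fin 5 → FinGraph) :
    IsSubst (buoy B).graph (cycleGraph 5) Sigma.fst := by
  intro u v huv
  refine ⟨?_, Or.inl⟩
  rintro (h | ⟨j, a, b, rfl, rfl, h⟩)
  · exact h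
  · exact absurd rfl huv

theorem cls_sub_buoy (B : Fin 5 → FinGraph) (i : Fin 5) :
    ((buoy B).sub (Sigma.fst ⁻¹' {i})).cls = (B i).cls := by
  refine cls_eq_iff.2 ⟨RelIso.symm ⟨Equiv.ofBijective
    (fun x => ⟨⟨i, x⟩, rfl⟩) ⟨fun x y h => ?_, ?_⟩, ?_⟩⟩
  · exact sigma_mk_injective (β := fun i => (B i).V) (congrArg Subtype.val h)
  · rintro ⟨⟨j, x⟩, hx⟩
    obtain rfl : j = i := hx
    exact ⟨x, rfl⟩
  · intro x y
    exact buoy_adj_same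

/-- Converse of `buoy_isSubst`: it turns the abstract decomposition into a member of
`buoysOfPattern`. -/
theorem cls_eq_buoy {G : FinGraph} {π : G.V → Fin 5} (h : IsSubst G.graph (cycleGraph 5) π) :
    G.cls = (buoy fun i => G.sub (π ⁻¹' {i})).cls := by
  refine cls_eq_iff.2 ⟨RelIso.symm ⟨Equiv.ofBijective (fun x => (x.2.1 : G.V)) ⟨?_, ?_⟩, ?_⟩⟩
  · rintro ⟨i, x, hx⟩ ⟨j, y, hy⟩ (e : x = y)
    obtain rfl : π x = i := hx
    obtain rfl : π y = j := hy
    subst e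
    rfl
  · exact fun x => ⟨⟨π x, x, rfl⟩, rfl⟩
  · rintro ⟨i, x, hx⟩ ⟨j, y, hy⟩
    change G.graph.Adj x y ↔ _
    have hx' : π x = i := hx
    have hy' : π y = j := hy
    by_cases hij : i = j
    · subst hij
      exact (buoy_adj_same (B := fun i => G.sub (π ⁻¹' {i})) (x := ⟨x, hx⟩) (y := ⟨y, hy⟩)).symm
    · rw [h x y (by rwa [hx', hy']), hx', hy']
      exact (buoy_isSubst (fun i => G.sub (π ⁻¹' {i})) ⟨i, x, hx⟩ ⟨j, y, hy⟩ hij).symm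

theorem cls_eq_join {G : FinGraph} {π : G.V → Bool} (h : IsSubst G.graph ⊤ π) :
    G.cls = (join (G.sub (π ⁻¹' {false})) (G.sub (π ⁻¹' {true}))).cls := by
  refine cls_eq_iff.2 ⟨RelIso.symm ⟨Equiv.ofBijective
    (fun x => (Sum.elim Subtype.val Subtype.val x : G.V)) ⟨?_, ?_⟩, ?_⟩⟩
  · rintro (⟨x, hx⟩ | ⟨x, hx⟩) (⟨y, hy⟩ | ⟨y, hy⟩) (e : x = y) <;> subst e
    · rfl
    · exact absurd (Eq.trans (Eq.symm hx) hy) (by decide)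
    · exact absurd (Eq.trans (Eq.symm hx) hy) (by decide)
    · rfl
  · intro x
    cases hx : π x
    · exact ⟨Sum.inl ⟨x, hx⟩, rfl⟩
    · exact ⟨Sum.inr ⟨x, hx⟩, rfl⟩
  · rintro (⟨x, hx⟩ | ⟨x, hx⟩) (⟨y, hy⟩ | ⟨y, hy⟩) <;> change G.graph.Adj x y ↔ _
    · exact (join_adj_inl (G := G.sub (π ⁻¹' {false})) (H := G.sub (π ⁻¹' {true}))
        (x := ⟨x, hx⟩) (y := ⟨y, hy⟩)).symm
    · have hne : π x ≠ π y := by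
        rw [show π x = _ from hx, show π y = _ from hy]
        decide
      exact iff_of_true ((h x y hne).2 hne) (join_adj_inl_inr _ _)
    · have hne : π x ≠ π y := by
        rw [show π x = _ from hx, show π y = _ from hy]
        decide
      exact iff_of_true ((h x y hne).2 hne) (join_adj_inl_inr _ _).symm
    · exact (join_adj_inr (G := G.sub (π ⁻¹' {false})) (H := G.sub (π ⁻¹' {true}))
        (x := ⟨x, hx⟩) (y := ⟨y, hy⟩)).symm

theorem join_mem_critFamily {G H : FinGraph} {a b : ℕ} (ha : 0 < a) (hb : 0 < b)
    (hG : G.cls ∈ critFamily a) (hH : H.cls ∈ critFamily b) :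
    (join G H).cls ∈ critFamily (a + b) := by
  obtain ⟨a, rfl⟩ := Nat.exists_eq_succ_of_ne_zero ha.ne'
  obtain ⟨b, rfl⟩ := Nat.exists_eq_succ_of_ne_zero hb.ne'
  have hw : ∀ i, (join G H).graph.CritOn (Sum.isRight ⁻¹' {i}) (cond i b a) ∧
      ((join G H).sub (Sum.isRight ⁻¹' {i})).IsP5CoP5Free := by
    intro i
    rw [← sub_cls_mem_critFamily]
    cases i
    · rwa [cls_sub_join_false]
    · rwa [cls_sub_join_true]
  rw [show a.succ + b.succ = a + b + 1 + 1 by omega, cls_mem_critFamily]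
  exact ⟨(join_isSubst G H).critOn_of_top fun i => (hw i).1,
    isP5CoP5Free_of_top (join_isSubst G H) fun i => (hw i).2⟩

theorem buoy_mem_critFamily {B : Fin 5 → FinGraph} {p : Fin 5 → ℕ} {k : ℕ} (hp : IsPattern k p)
    (hB : ∀ i, (B i).cls ∈ critFamily (p i)) : (buoy B).cls ∈ critFamily k := by
  obtain ⟨hpos, hpair, hsum⟩ := hp
  obtain ⟨w, rfl⟩ : ∃ w : Fin 5 → ℕ, p = fun i => w i + 1 :=
    ⟨fun i => p i - 1, funext fun i => (Nat.succ_pred_eq_of_pos (hpos i)).symm⟩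
  obtain ⟨m, rfl⟩ : ∃ m, k = m + 1 := ⟨k - 1, by omega⟩
  have hw : ∀ i, (buoy B).graph.CritOn (Sigma.fst ⁻¹' {i}) (w i) ∧
      ((buoy B).sub (Sigma.fst ⁻¹' {i})).IsP5CoP5Free := by
    intro i
    rw [← sub_cls_mem_critFamily, cls_sub_buoy]
    exact hB i
  rw [cls_mem_critFamily]
  exact ⟨(buoy_isSubst B).critOn_of_cycle (fun i => (hw i).1)
    (fun i => Nat.le_of_succ_le_succ (hpair i)) (by simp only at hsum; omega),
    isP5CoP5Free_of_cycle (buoy_isSubst B) fun i => (hw i).2⟩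

/-- The critical graphs without induced `P₅` and house on at least two vertices are the joins
and the buoys. -/
theorem critFamily_eq {k : ℕ} (hk : 2 ≤ k) : critFamily k = joinFamily k ∪ buoyFamily k := by
  ext c
  constructor
  · intro hc
    obtain ⟨G, rfl⟩ : ∃ G : FinGraph, G.cls = c := Quotient.exists_rep c
    obtain ⟨m, rfl⟩ : ∃ m, k = m + 1 := ⟨k - 1, by omega⟩
    have := G.finite
    obtain ⟨hG, hfree⟩ := cls_mem_critFamily.1 hc
    rcases hG.join_or_buoy (by omega) hfree.1 hfree.2 with ⟨π, hπ, h⟩ | ⟨π, hπ, h⟩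
    · left
      choose w hw using fun i => h.exists_critOn_fiber hG (i := i) (hπ i)
      have := hG.unique (h.critOn_of_top hw)
      exact ⟨w false + 1, w true + 1, by omega, by omega, by omega, _, _,
        sub_cls_mem_critFamily.2 ⟨hw false, sub_isP5CoP5Free hfree⟩,
        sub_cls_mem_critFamily.2 ⟨hw true, sub_isP5CoP5Free hfree⟩, cls_eq_join h⟩
    · right
      choose w hw using fun i => h.exists_critOn_fiber hG (i := i) (hπ i)
      obtain ⟨h1, h2⟩ := h.pattern_of_critOn hw hG
      exact ⟨fun i => w i + 1, ⟨fun i => Nat.succ_pos _, fun i => Nat.succ_le_succ (h1 i),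
        by simp only; omega⟩, _, fun i => sub_cls_mem_critFamily.2 ⟨hw i, sub_isP5CoP5Free hfree⟩,
        cls_eq_buoy h⟩
  · rintro (⟨a, b, ha, hb, rfl, G, H, hG, hH, rfl⟩ | ⟨p, hp, B, hB, rfl⟩)
    · exact join_mem_critFamily ha hb hG hH
    · exact buoy_mem_critFamily hp hB

end FinGraph

/-! ### Invariance of joins and buoys under isomorphism and symmetry -/

namespace FinGraph

open SimpleGraph

theorem join_congr {G G' H H' : FinGraph} (hG : G.cls = G'.cls) (hH : H.cls = H'.cls) :
    (join G H).cls = (join G' H').cls := by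
  obtain ⟨e⟩ := cls_eq_iff.1 hG
  obtain ⟨f⟩ := cls_eq_iff.1 hH
  refine cls_eq_iff.2 ⟨⟨Equiv.sumCongr e.toEquiv f.toEquiv, ?_⟩⟩
  rintro (x | x) (y | y)
  · exact join_adj_inl.trans (e.map_rel_iff.trans join_adj_inl.symm)
  · exact iff_of_true (join_adj_inl_inr _ _) (join_adj_inl_inr _ _)
  · exact iff_of_true (join_adj_inl_inr _ _).symm (join_adj_inl_inr _ _).symm
  · exact join_adj_inr.trans (f.map_rel_iff.trans join_adj_inr.symm)

theorem join_comm (G H : FinGraph) : (join G H).cls = (join H G).cls := by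
  refine cls_eq_iff.2 ⟨⟨Equiv.sumComm _ _, ?_⟩⟩
  rintro (x | x) (y | y)
  · exact join_adj_inr.trans join_adj_inl.symm
  · exact iff_of_true (join_adj_inl_inr _ _).symm (join_adj_inl_inr _ _)
  · exact iff_of_true (join_adj_inl_inr _ _) (join_adj_inl_inr _ _).symm
  · exact join_adj_inl.trans join_adj_inr.symm

theorem join_assoc (G H J : FinGraph) :
    (join (join G H) J).cls = (join G (join H J)).cls := by
  refine cls_eq_iff.2 ⟨⟨Equiv.sumAssoc _ _ _, ?_⟩⟩
  rintro ((x | x) | x) ((y | y) | y)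
  · exact join_adj_inl.trans (join_adj_inl.trans join_adj_inl).symm
  · exact iff_of_true (join_adj_inl_inr _ _) (join_adj_inl.2 (join_adj_inl_inr _ _))
  · exact iff_of_true (join_adj_inl_inr _ _) (join_adj_inl_inr _ _)
  · exact iff_of_true (join_adj_inl_inr _ _).symm (join_adj_inl.2 (join_adj_inl_inr _ _).symm)
  · exact (join_adj_inr.trans join_adj_inl).trans (join_adj_inl.trans join_adj_inr).symm
  · exact iff_of_true (join_adj_inr.2 (join_adj_inl_inr _ _)) (join_adj_inl_inr _ _)
  · exact iff_of_true (join_adj_inl_inr _ _).symm (join_adj_inl_inr _ _).symm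
  · exact iff_of_true (join_adj_inr.2 (join_adj_inl_inr _ _).symm) (join_adj_inl_inr _ _).symm
  · exact (join_adj_inr.trans join_adj_inr).trans join_adj_inr.symm

theorem buoy_congr {B B' : Fin 5 → FinGraph} (h : ∀ i, (B i).cls = (B' i).cls) :
    (buoy B).cls = (buoy B').cls := by
  have e : ∀ i, (B i).graph ≃g (B' i).graph := fun i => (cls_eq_iff.1 (h i)).some
  refine cls_eq_iff.2 ⟨⟨Equiv.sigmaCongrRight fun i => (e i).toEquiv, ?_⟩⟩
  rintro ⟨i, x⟩ ⟨j, y⟩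
  by_cases hij : i = j
  · subst hij
    exact buoy_adj_same.trans ((e i).map_rel_iff.trans buoy_adj_same.symm)
  · exact (buoy_isSubst B' ⟨i, e i x⟩ ⟨j, e j y⟩ hij).trans
      (buoy_isSubst B ⟨i, x⟩ ⟨j, y⟩ hij).symm

/-- Relabelling the bags by a symmetry of `C₅` gives a second substitution structure on the same
graph, and a graph is the buoy of its fibres. -/
theorem buoy_comp_perm (B : Fin 5 → FinGraph) (σ : Equiv.Perm (Fin 5))
    (hσ : ∀ i j, (cycleGraph 5).Adj (σ i) (σ j) ↔ (cycleGraph 5).Adj i j) :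
    (buoy (B ∘ σ)).cls = (buoy B).cls := by
  have hs : IsSubst (buoy B).graph (cycleGraph 5) fun x => σ.symm x.1 := by
    intro u v huv
    rw [buoy_isSubst B u v fun e => huv (congrArg σ.symm e),
      ← hσ (σ.symm u.1) (σ.symm v.1), Equiv.apply_symm_apply, Equiv.apply_symm_apply]
  rw [cls_eq_buoy hs]
  refine buoy_congr fun i => ?_
  rw [Function.comp_apply, ← cls_sub_buoy B (σ i)]
  congr 2
  ext x
  exact σ.symm_apply_eq.symm

theorem buoysOfPattern_subset {p q : Fin 5 → ℕ} (σ : Equiv.Perm (Fin 5))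
    (hσ : ∀ i j, (cycleGraph 5).Adj (σ i) (σ j) ↔ (cycleGraph 5).Adj i j)
    (h : ∀ i, p i = q (σ i)) : buoysOfPattern p ⊆ buoysOfPattern q := by
  rintro _ ⟨B, hB, rfl⟩
  refine ⟨B ∘ σ.symm, fun i => ?_, ?_⟩
  · have := hB (σ.symm i)
    rwa [h, Equiv.apply_symm_apply] at this
  · rw [← buoy_comp_perm (B ∘ σ.symm) σ hσ]
    congr 2
    funext i
    simp

theorem buoysOfPattern_congr {p q : Fin 5 → ℕ} (h : CircEquiv p q) :
    buoysOfPattern p = buoysOfPattern q := by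
  have key : ∀ σ : Equiv.Perm (Fin 5),
      (∀ i j, (cycleGraph 5).Adj (σ i) (σ j) ↔ (cycleGraph 5).Adj i j) →
      (∀ i, p i = q (σ i)) → buoysOfPattern p = buoysOfPattern q := fun σ hσ h =>
    (buoysOfPattern_subset σ hσ h).antisymm (buoysOfPattern_subset σ.symm
      (fun i j => by rw [← hσ]; simp) fun i => by rw [h]; simp)
  obtain ⟨c, h | h⟩ := h
  · refine key (Equiv.addLeft c) ?_ h
    simp only [Equiv.coe_addLeft]
    clear h
    revert c
    decide
  · refine key (Equiv.subLeft c) ?_ h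
    simp only [Equiv.subLeft_apply]
    clear h
    revert c
    decide

theorem buoyFamily_eq {k : ℕ} {L : List (Fin 5 → ℕ)} (h : PatternsAre k L) :
    buoyFamily k = {c | ∃ q ∈ L, c ∈ buoysOfPattern q} := by
  ext c
  constructor
  · rintro ⟨p, hp, hc⟩
    obtain ⟨q, hq, hpq⟩ := (h.1 p).1 hp
    exact ⟨q, hq, buoysOfPattern_congr hpq ▸ hc⟩
  · rintro ⟨q, hq, hc⟩
    exact ⟨q, (h.1 q).2 ⟨q, hq, 0, Or.inl fun i => by rw [zero_add]⟩, hc⟩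

/-! ### Enumeration of admissible patterns -/

instance : DecidableRel CircEquiv := fun p q =>
  inferInstanceAs (Decidable (∃ c : Fin 5, (∀ i, p i = q (c + i)) ∨ (∀ i, p i = q (c - i))))

instance (k : ℕ) (p : Fin 5 → ℕ) : Decidable (IsPattern k p) :=
  inferInstanceAs (Decidable
    ((∀ i, 0 < p i) ∧ (∀ i, p i + p (i + 1) + 1 ≤ k) ∧ ∑ i, p i + 1 = 2 * k))

theorem isPattern_vec {k a b c d e : ℕ} : IsPattern k ![a, b, c, d, e] ↔
    (0 < a ∧ 0 < b ∧ 0 < c ∧ 0 < d ∧ 0 < e) ∧ (a + b + 1 ≤ k ∧ b + c + 1 ≤ k ∧ c + d + 1 ≤ k ∧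
      d + e + 1 ≤ k ∧ e + a + 1 ≤ k) ∧ a + b + c + d + e + 1 = 2 * k := by
  simp [IsPattern, Fin.forall_fin_succ, Fin.sum_univ_five]

theorem isPattern_of_circEquiv {k : ℕ} {p q : Fin 5 → ℕ} (hq : IsPattern k q)
    (h : CircEquiv p q) : IsPattern k p := by
  obtain ⟨h1, h2, h3⟩ := hq
  obtain ⟨c, h | h⟩ := h
  · obtain rfl : p = fun i => q (c + i) := funext h
    refine ⟨fun i => h1 _, fun i => by simpa only [add_assoc] using h2 (c + i), ?_⟩
    rw [← h3, ← Equiv.sum_comp (Equiv.addLeft c) q]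
    rfl
  · obtain rfl : p = fun i => q (c - i) := funext h
    refine ⟨fun i => h1 _, fun i => ?_, ?_⟩
    · have := h2 (c - (i + 1))
      rw [show c - (i + 1) + 1 = c - i by abel] at this
      simp only
      omega
    · rw [← h3, ← Equiv.sum_comp (Equiv.subLeft c) q]
      rfl

theorem patternsAre_of {k : ℕ} {L : List (Fin 5 → ℕ)} (h1 : ∀ q ∈ L, IsPattern k q)
    (h2 : ∀ a b c d e : ℕ, IsPattern k ![a, b, c, d, e] →
      ∃ q ∈ L, CircEquiv ![a, b, c, d, e] q)
    (h3 : L.Pairwise fun p q => ¬ CircEquiv p q) : PatternsAre k L := by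
  refine ⟨fun p => ⟨fun hp => ?_, ?_⟩, h3⟩
  · have he : p = ![p 0, p 1, p 2, p 3, p 4] := by
      funext i
      fin_cases i <;> rfl
    rw [he] at hp ⊢
    exact h2 _ _ _ _ _ hp
  · rintro ⟨q, hq, h⟩
    exact isPattern_of_circEquiv (h1 q hq) h

theorem patternsAre_three : PatternsAre 3 [![1, 1, 1, 1, 1]] := by
  refine patternsAre_of (by decide) (fun a b c d e h => ?_) (by decide)
  rw [isPattern_vec] at h
  obtain ⟨rfl, rfl, rfl, rfl, rfl⟩ : a = 1 ∧ b = 1 ∧ c = 1 ∧ d = 1 ∧ e = 1 := by omega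
  decide

theorem patternsAre_four : PatternsAre 4 [![1, 2, 1, 2, 1]] := by
  refine patternsAre_of (by decide) (fun a b c d e h => ?_) (by decide)
  rw [isPattern_vec] at h
  -- Entries are at most `k - 2`, since a neighbouring entry is at least 1; the last entry is then
  -- determined by the total `2 k - 1 = 7`.
  have ha : a = 1 ∨ a = 2 := by omega
  have hb : b = 1 ∨ b = 2 := by omega
  have hc : c = 1 ∨ c = 2 := by omega
  have hd : d = 1 ∨ d = 2 := by omega
  have he : e = 7 - a - b - c - d := by omega
  rcases ha with rfl | rfl <;> rcases hb with rfl | rfl <;> try omega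
  all_goals rcases hc with rfl | rfl <;> try omega
  all_goals rcases hd with rfl | rfl <;> try omega
  all_goals (subst he; decide)

theorem patternsAre_five :
    PatternsAre 5 [![2, 2, 2, 2, 1], ![2, 1, 3, 1, 2], ![1, 3, 1, 3, 1]] := by
  refine patternsAre_of (by decide) (fun a b c d e h => ?_) (by decide)
  rw [isPattern_vec] at h
  have ha : a = 1 ∨ a = 2 ∨ a = 3 := by omega
  have hb : b = 1 ∨ b = 2 ∨ b = 3 := by omega
  have hc : c = 1 ∨ c = 2 ∨ c = 3 := by omega
  have hd : d = 1 ∨ d = 2 ∨ d = 3 := by omega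
  have he : e = 9 - a - b - c - d := by omega
  rcases ha with rfl | rfl | rfl <;> rcases hb with rfl | rfl | rfl <;> try omega
  all_goals rcases hc with rfl | rfl | rfl <;> try omega
  all_goals rcases hd with rfl | rfl | rfl <;> try omega
  all_goals (subst he; decide)

theorem patternsAre_six : PatternsAre 6 [![2, 2, 2, 2, 3], ![2, 3, 2, 3, 1], ![2, 3, 1, 3, 2],
    ![1, 4, 1, 3, 2], ![1, 4, 1, 4, 1]] := by
  refine patternsAre_of (by decide) (fun a b c d e h => ?_) (by decide)
  rw [isPattern_vec] at h
  have ha : a = 1 ∨ a = 2 ∨ a = 3 ∨ a = 4 := by omega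
  have hb : b = 1 ∨ b = 2 ∨ b = 3 ∨ b = 4 := by omega
  have hc : c = 1 ∨ c = 2 ∨ c = 3 ∨ c = 4 := by omega
  have hd : d = 1 ∨ d = 2 ∨ d = 3 ∨ d = 4 := by omega
  have he : e = 11 - a - b - c - d := by omega
  rcases ha with rfl | rfl | rfl | rfl <;> rcases hb with rfl | rfl | rfl | rfl <;> try omega
  all_goals rcases hc with rfl | rfl | rfl | rfl <;> try omega
  all_goals rcases hd with rfl | rfl | rfl | rfl <;> try omega
  all_goals (subst he; decide)

/-! ### A degree invariant of isomorphism classes -/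

/-- The number of vertices, the sum of the degrees and the sum of the squares of the degrees. -/
noncomputable def degInv (G : FinGraph) : ℕ × ℕ × ℕ :=
  letI := G.finite
  letI := Fintype.ofFinite G.V
  ∑ v, (1, (G.graph.neighborSet v).ncard, (G.graph.neighborSet v).ncard ^ 2)

/-- The effect on `degInv` of adding `m` to all degrees. -/
def shift (t : ℕ × ℕ × ℕ) (m : ℕ) : ℕ × ℕ × ℕ :=
  (t.1, t.2.1 + m * t.1, t.2.2 + 2 * m * t.2.1 + m ^ 2 * t.1)

theorem degInv_eq (G : FinGraph) [Fintype G.V] : G.degInv =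
    ∑ v, (1, (G.graph.neighborSet v).ncard, (G.graph.neighborSet v).ncard ^ 2) := by
  unfold degInv
  convert rfl

theorem degInv_fst (G : FinGraph) : G.degInv.1 = Nat.card G.V := by
  have := G.finite
  have := Fintype.ofFinite G.V
  rw [degInv_eq, Prod.fst_sum]
  simp

theorem shift_degInv (G : FinGraph) [Fintype G.V] (m : ℕ) : shift G.degInv m =
    ∑ v, (1, (G.graph.neighborSet v).ncard + m, ((G.graph.neighborSet v).ncard + m) ^ 2) := by
  rw [degInv_eq]
  simp only [shift, Prod.fst_sum, Prod.snd_sum]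
  ext
  · simp [Prod.fst_sum]
  · simp [Prod.fst_sum, Prod.snd_sum, Finset.sum_add_distrib, mul_comm]
  · simp only [Prod.snd_sum, add_sq, Finset.sum_add_distrib, Finset.mul_sum]
    simp only [Finset.sum_const, smul_eq_mul, one_mul, mul_comm, mul_assoc]

theorem degInv_congr {G H : FinGraph} (h : G.cls = H.cls) : G.degInv = H.degInv := by
  obtain ⟨e⟩ := cls_eq_iff.1 h
  have := G.finite
  have := H.finite
  have := Fintype.ofFinite G.V
  have := Fintype.ofFinite H.V
  rw [degInv_eq, degInv_eq]
  refine Fintype.sum_equiv e.toEquiv _ _ fun v => ?_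
  have : (H.graph.neighborSet (e v)).ncard = (G.graph.neighborSet v).ncard := by
    rw [← Set.ncard_image_of_injective _ e.injective]
    congr 1
    ext w
    obtain ⟨w, rfl⟩ := e.surjective w
    rw [e.injective.mem_set_image]
    exact e.map_rel_iff
  exact (congrArg (fun n => (1, n, n ^ 2)) this).symm

theorem ncard_sum {α β : Type*} [Finite α] [Finite β] (S : Set (α ⊕ β)) :
    S.ncard = (Sum.inl ⁻¹' S).ncard + (Sum.inr ⁻¹' S).ncard :=
  (Nat.card_congr (Equiv.subtypeSum (p := (· ∈ S)))).trans Nat.card_sum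

theorem ncard_sigma {ι : Type*} [Fintype ι] {X : ι → Type*} [∀ i, Finite (X i)]
    (S : Set (Σ i, X i)) : S.ncard = ∑ i, (Sigma.mk i ⁻¹' S).ncard := by
  let e : S ≃ Σ i, (Sigma.mk i ⁻¹' S : Set (X i)) :=
    ⟨fun x => ⟨x.1.1, x.1.2, x.2⟩, fun y => ⟨⟨y.1, y.2.1⟩, y.2.2⟩, fun _ => rfl, fun _ => rfl⟩
  exact (Nat.card_congr e).trans Nat.card_sigma

/-- All degrees on one side grow by the order of the other side, so the invariant of a join depends
only on those of its sides. -/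
theorem degInv_join (G H : FinGraph) :
    (join G H).degInv = shift G.degInv H.degInv.1 + shift H.degInv G.degInv.1 := by
  have := G.finite
  have := H.finite
  have := Fintype.ofFinite G.V
  have := Fintype.ofFinite H.V
  let _ : Fintype (join G H).V := inferInstanceAs (Fintype (G.V ⊕ H.V))
  rw [degInv_eq (join G H), shift_degInv, shift_degInv, degInv_fst, degInv_fst]
  have h1 : ∀ v : G.V, ((join G H).graph.neighborSet (Sum.inl v)).ncard =
      (G.graph.neighborSet v).ncard + Nat.card H.V := by
    intro v
    have e1 : (Sum.inl ⁻¹' (join G H).graph.neighborSet (Sum.inl v) : Set G.V) =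
        G.graph.neighborSet v := Set.ext fun w => join_adj_inl
    have e2 : (Sum.inr ⁻¹' (join G H).graph.neighborSet (Sum.inl v) : Set H.V) =
        Set.univ := Set.eq_univ_of_forall fun w => join_adj_inl_inr v w
    refine (ncard_sum (α := G.V) (β := H.V) _).trans ?_
    rw [e1, e2, Set.ncard_univ]
  have h2 : ∀ v : H.V, ((join G H).graph.neighborSet (Sum.inr v)).ncard =
      (H.graph.neighborSet v).ncard + Nat.card G.V := by
    intro v
    have e1 : (Sum.inr ⁻¹' (join G H).graph.neighborSet (Sum.inr v) : Set H.V) =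
        H.graph.neighborSet v := Set.ext fun w => join_adj_inr
    have e2 : (Sum.inl ⁻¹' (join G H).graph.neighborSet (Sum.inr v) : Set G.V) =
        Set.univ := Set.eq_univ_of_forall fun w => (join_adj_inl_inr w v).symm
    refine (ncard_sum (α := G.V) (β := H.V) _).trans ?_
    rw [e1, e2, Set.ncard_univ, add_comm]
  refine (Fintype.sum_sum_type _).trans ?_
  simp only [h1, h2]

theorem ncard_neighborSet_buoy (B : Fin 5 → FinGraph) (i : Fin 5) (v : (B i).V) :
    ((buoy B).graph.neighborSet ⟨i, v⟩).ncard =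
      ((B i).graph.neighborSet v).ncard + (Nat.card (B (i + 1)).V + Nat.card (B (i + 4)).V) := by
  have := fun i => (B i).finite
  have hcyc : ∀ i : Fin 5, (cycleGraph 5).Adj i (i + 1) ∧ ¬ (cycleGraph 5).Adj i (i + 2) ∧
      ¬ (cycleGraph 5).Adj i (i + 3) ∧ (cycleGraph 5).Adj i (i + 4) ∧ i ≠ i + 2 ∧
      i ≠ i + 3 := by decide
  obtain ⟨c1, c2, c3, c4, n2, n3⟩ := hcyc i
  have hadj : ∀ j, (cycleGraph 5).Adj i j →
      Sigma.mk (β := fun i => (B i).V) j ⁻¹' (buoy B).graph.neighborSet ⟨i, v⟩ = Set.univ :=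
    fun j hj => Set.eq_univ_of_forall fun w =>
      (show (buoy B).graph.Adj ⟨i, v⟩ ⟨j, w⟩ from Or.inl hj)
  have hnot : ∀ j, i ≠ j → ¬ (cycleGraph 5).Adj i j →
      Sigma.mk (β := fun i => (B i).V) j ⁻¹' (buoy B).graph.neighborSet ⟨i, v⟩ = ∅ :=
    fun j hij hj => Set.eq_empty_of_forall_notMem fun w hw =>
      hj ((buoy_isSubst B ⟨i, v⟩ ⟨j, w⟩ hij).1 hw)
  have hself : Sigma.mk (β := fun i => (B i).V) i ⁻¹' (buoy B).graph.neighborSet ⟨i, v⟩ =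
      (B i).graph.neighborSet v := Set.ext fun w => buoy_adj_same
  refine (ncard_sigma (X := fun i => (B i).V) _).trans ?_
  have hsum : ∀ f : Fin 5 → ℕ,
      ∑ j, f j = f i + f (i + 1) + f (i + 2) + f (i + 3) + f (i + 4) := fun f => by
    rw [← Equiv.sum_comp (Equiv.addLeft i), Fin.sum_univ_five]
    simp
  rw [hsum, hself, hadj _ c1, hnot _ n2 c2, hnot _ n3 c3, hadj _ c4]
  simp [Set.ncard_univ, add_assoc]

/-- Degrees in bag `i` grow by the orders of the two neighbouring bags, of index `i + 1` and `i + 4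
= i - 1`. -/
theorem degInv_buoy (B : Fin 5 → FinGraph) : (buoy B).degInv =
    ∑ i, shift (B i).degInv ((B (i + 1)).degInv.1 + (B (i + 4)).degInv.1) := by
  have := fun i => (B i).finite
  have := fun i => Fintype.ofFinite (B i).V
  let _ : Fintype (buoy B).V := inferInstanceAs (Fintype (Σ i, (B i).V))
  simp only [degInv_eq (buoy B), shift_degInv, degInv_fst]
  refine (Fintype.sum_sigma _).trans ?_
  simp only [ncard_neighborSet_buoy]

end FinGraph

/-! ### Terms for joins and buoys -/

namespace FinGraph

open SimpleGraph

/-- Terms for the graphs obtained from one-vertex graphs by joins and buoys. -/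
inductive BuoyTerm : Type
  | pt : BuoyTerm
  | join (s t : BuoyTerm) : BuoyTerm
  | buoy (a b c d e : BuoyTerm) : BuoyTerm

namespace BuoyTerm

/-- The graph denoted by a term. -/
def eval : BuoyTerm → FinGraph
  | pt => K 1
  | join s t => FinGraph.join s.eval t.eval
  | buoy a b c d e => FinGraph.buoy ![a.eval, b.eval, c.eval, d.eval, e.eval]

/-- The isomorphism class of the graph denoted by a term. -/
def toCls (t : BuoyTerm) : IsoClass := t.eval.cls

/-- The value of `degInv` at the graph denoted by a term. -/
def inv : BuoyTerm → ℕ × ℕ × ℕ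
  | pt => (1, 0, 0)
  | join s t => shift s.inv t.inv.1 + shift t.inv s.inv.1
  | buoy a b c d e => shift a.inv (b.inv.1 + e.inv.1) + shift b.inv (c.inv.1 + a.inv.1) +
      shift c.inv (d.inv.1 + b.inv.1) + shift d.inv (e.inv.1 + c.inv.1) +
      shift e.inv (a.inv.1 + d.inv.1)

/-- Replaces the noncomputable `degInv` by a recursion on terms, so that graphs can be told apart by
`decide`. -/
theorem degInv_eval (t : BuoyTerm) : t.eval.degInv = t.inv := by
  induction t with
  | pt =>
    let _ : Fintype (eval pt).V := inferInstanceAs (Fintype (Fin 1))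
    have hN : ∀ v : (eval pt).V, (eval pt).graph.neighborSet v = ∅ := fun v =>
      Set.eq_empty_of_forall_notMem fun w h =>
        (show (eval pt).graph.Adj v w from h).ne (Subsingleton.elim (α := Fin 1) v w)
    rw [degInv_eq]
    simp only [hN, Set.ncard_empty]
    rfl
  | join s t hs ht => rw [eval, degInv_join, hs, ht, inv]
  | buoy a b c d e ha hb hc hd he =>
    rw [eval, degInv_buoy, Fin.sum_univ_five, inv, ← ha, ← hb, ← hc, ← hd, ← he]
    rfl

theorem inv_eq_of_toCls_eq {s t : BuoyTerm} (h : s.toCls = t.toCls) : s.inv = t.inv := by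
  rw [← degInv_eval, ← degInv_eval, degInv_congr h]

/-- The reflection `i ↦ 4 - i` of the cycle; it removes the duplicates in patterns that are
palindromes. -/
theorem toCls_buoy_reverse (a b c d e : BuoyTerm) :
    (buoy a b c d e).toCls = (buoy e d c b a).toCls := by
  refine Eq.trans ?_ (buoy_comp_perm ![e.eval, d.eval, c.eval, b.eval, a.eval]
    (Equiv.subLeft 4) (by simp only [Equiv.subLeft_apply]; decide))
  refine congrArg (fun B => (FinGraph.buoy B).cls) (funext fun i => ?_)
  fin_cases i <;> rfl

/-- The set of isomorphism classes denoted by the terms in a list. -/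
def classes (L : List BuoyTerm) : Set IsoClass := {c | ∃ t ∈ L, t.toCls = c}

theorem classes_nil : classes [] = ∅ := by
  simp [classes]

theorem classes_cons (t : BuoyTerm) (L : List BuoyTerm) :
    classes (t :: L) = insert t.toCls (classes L) := by
  ext c
  simp [classes, eq_comm]

theorem classes_append (L M : List BuoyTerm) : classes (L ++ M) = classes L ∪ classes M := by
  ext c
  simp [classes, or_and_right, exists_or]

/-- Distinct invariants mean non-isomorphic graphs, so the list counts each class once. -/
theorem encard_classes {L : List BuoyTerm} (h : (L.map inv).Nodup) :
    (classes L).encard = L.length := by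
  classical
  have hL : (L.map toCls).Nodup := by
    rw [List.nodup_map_iff_inj_on (List.Nodup.of_map _ h)]
    exact fun s hs t ht hst => List.inj_on_of_nodup_map h hs ht (inv_eq_of_toCls_eq hst)
  have hset : classes L = ((L.map toCls).toFinset : Set IsoClass) := by
    ext c
    simp [classes]
  rw [hset, Set.encard_coe_eq_coe_finsetCard, List.toFinset_card_of_nodup hL, List.length_map]

theorem joinSet_classes (L M : List BuoyTerm) :
    joinSet (classes L) (classes M) = classes (L.flatMap fun s => M.map fun t => join s t) := by
  ext c
  constructor
  · rintro ⟨G, H, ⟨s, hs, hG⟩, ⟨t, ht, hH⟩, rfl⟩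
    exact ⟨join s t, List.mem_flatMap.2 ⟨s, hs, List.mem_map.2 ⟨t, ht, rfl⟩⟩, join_congr hG hH⟩
  · rintro ⟨u, hu, rfl⟩
    obtain ⟨s, hs, hu⟩ := List.mem_flatMap.1 hu
    obtain ⟨t, ht, rfl⟩ := List.mem_map.1 hu
    exact ⟨s.eval, t.eval, ⟨s, hs, rfl⟩, ⟨t, ht, rfl⟩, rfl⟩

/-- All buoys with bags from given lists. -/
def buoyList (A B C D E : List BuoyTerm) : List BuoyTerm :=
  A.flatMap fun a => B.flatMap fun b => C.flatMap fun c => D.flatMap fun d => E.map fun e =>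
    buoy a b c d e

theorem buoysOfPattern_eq_classes {a b c d e : ℕ} {A B C D E : List BuoyTerm}
    (hA : critFamily a = classes A) (hB : critFamily b = classes B)
    (hC : critFamily c = classes C) (hD : critFamily d = classes D)
    (hE : critFamily e = classes E) :
    buoysOfPattern ![a, b, c, d, e] = classes (buoyList A B C D E) := by
  ext x
  constructor
  · rintro ⟨G, hG, rfl⟩
    have h0 := hG 0
    have h1 := hG 1
    have h2 := hG 2
    have h3 := hG 3
    have h4 := hG 4
    rw [show ![a, b, c, d, e] 0 = a from rfl, hA] at h0
    rw [show ![a, b, c, d, e] 1 = b from rfl, hB] at h1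
    rw [show ![a, b, c, d, e] 2 = c from rfl, hC] at h2
    rw [show ![a, b, c, d, e] 3 = d from rfl, hD] at h3
    rw [show ![a, b, c, d, e] 4 = e from rfl, hE] at h4
    obtain ⟨t0, m0, e0⟩ := h0
    obtain ⟨t1, m1, e1⟩ := h1
    obtain ⟨t2, m2, e2⟩ := h2
    obtain ⟨t3, m3, e3⟩ := h3
    obtain ⟨t4, m4, e4⟩ := h4
    refine ⟨buoy t0 t1 t2 t3 t4, ?_, buoy_congr fun i => ?_⟩
    · simp only [buoyList, List.mem_flatMap, List.mem_map]
      exact ⟨t0, m0, t1, m1, t2, m2, t3, m3, t4, m4, rfl⟩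
    · fin_cases i
      exacts [e0, e1, e2, e3, e4]
  · rintro ⟨t, ht, rfl⟩
    simp only [buoyList, List.mem_flatMap, List.mem_map] at ht
    obtain ⟨t0, m0, t1, m1, t2, m2, t3, m3, t4, m4, rfl⟩ := ht
    refine ⟨_, fun i => ?_, rfl⟩
    fin_cases i
    · exact hA.ge ⟨t0, m0, rfl⟩
    · exact hB.ge ⟨t1, m1, rfl⟩
    · exact hC.ge ⟨t2, m2, rfl⟩
    · exact hD.ge ⟨t3, m3, rfl⟩
    · exact hE.ge ⟨t4, m4, rfl⟩

end BuoyTerm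

/-! ### Small cases and concrete graphs -/

theorem cls_eq_K {G : FinGraph} {n : ℕ} (h : ∀ x y, x ≠ y → G.graph.Adj x y)
    (hn : Nat.card G.V = n) : G.cls = (K n).cls := by
  have := G.finite
  obtain ⟨e⟩ : Nonempty (G.V ≃ Fin n) := ⟨Finite.equivFinOfCardEq hn⟩
  refine cls_eq_iff.2 ⟨⟨e, fun {x y} => ?_⟩⟩
  refine ⟨fun hxy => h x y fun he => hxy.ne (congrArg e he), fun hxy => ?_⟩
  exact fun he => hxy.ne (e.injective he)

theorem cls_K_succ (n : ℕ) : (K (n + 1)).cls = (join (K 1) (K n)).cls := by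
  refine (cls_eq_K ?_ ?_).symm
  · rintro (x | x) (y | y) hxy
    · exact join_adj_inl.2 fun e => hxy (congrArg Sum.inl e)
    · exact join_adj_inl_inr _ _
    · exact (join_adj_inl_inr _ _).symm
    · exact join_adj_inr.2 fun e => hxy (congrArg Sum.inr e)
  · change Nat.card (Fin 1 ⊕ Fin n) = n + 1
    simp [add_comm]

/-- The base of the recursion, where `critFamily_eq` does not apply: deleting any vertex must leave
a graph colourable with no colours, hence empty. -/
theorem critFamily_one : critFamily 1 = {(K 1).cls} := by
  ext c
  obtain ⟨G, rfl⟩ : ∃ G : FinGraph, G.cls = c := Quotient.exists_rep c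
  rw [cls_mem_critFamily (m := 0), Set.mem_singleton_iff]
  constructor
  · rintro ⟨h, -⟩
    obtain ⟨v, -⟩ := h.nonempty
    have hv : ∀ u, u = v := by
      intro u
      by_contra hne
      obtain ⟨c, hc, -⟩ := h.2 v trivial
      exact absurd (hc u ⟨trivial, hne⟩) (Nat.not_lt_zero _)
    refine cls_eq_K (fun x y hxy => absurd ((hv x).trans (hv y).symm) hxy) ?_
    have : Subsingleton G.V := ⟨fun x y => (hv x).trans (hv y).symm⟩
    have : Nonempty G.V := ⟨v⟩
    exact Nat.card_eq_one_iff_unique.2 ⟨inferInstance, inferInstance⟩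
  · intro h
    obtain ⟨e⟩ := cls_eq_iff.1 h
    have hsub : ∀ x y : G.V, x = y := fun x y =>
      e.injective (Subsingleton.elim (α := Fin 1) _ _)
    have hnot : ∀ H : SimpleGraph (Fin 5), ¬ H ⊴ G.graph := by
      rintro H ⟨f⟩
      exact absurd (f.injective (hsub (f 0) (f 1))) (by decide)
    refine ⟨⟨?_, fun v _ => ⟨fun _ => 0, ?_, ?_⟩⟩, hnot _, hnot _⟩
    · rintro ⟨c, hc, -⟩
      exact absurd (hc (e.symm (0 : Fin 1)) trivial) (Nat.not_lt_zero _)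
    · rintro u ⟨-, hu⟩
      exact absurd (hsub u v) hu
    · rintro u ⟨-, hu⟩
      exact absurd (hsub u v) hu

theorem joinSet_comm (A B : Set IsoClass) : joinSet A B = joinSet B A := by
  ext c
  constructor <;> rintro ⟨G, H, hG, hH, rfl⟩ <;> exact ⟨H, G, hH, hG, join_comm _ _⟩

/-- A join whose first factor has a vertex adjacent to all others is a join with one vertex. -/
theorem join_mem_joinSet_one {G H S : FinGraph} {a b : ℕ} (ha : 0 < a) (hb : 0 < b)
    (hG : G.cls = (join (K 1) S).cls) (hS : S.cls ∈ critFamily a) (hH : H.cls ∈ critFamily b) :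
    (join G H).cls ∈ joinSet (critFamily 1) (critFamily (a + b)) :=
  ⟨K 1, join S H, critFamily_one.ge rfl, join_mem_critFamily ha hb hS hH,
    (join_congr hG rfl).trans (join_assoc _ _ _)⟩

theorem buoyFamily_eq_empty {k : ℕ} (hk : k ≤ 2) : buoyFamily k = ∅ := by
  refine Set.eq_empty_of_forall_notMem ?_
  rintro c ⟨p, ⟨h1, -, h3⟩, -⟩
  rw [Fin.sum_univ_five] at h3
  have := h1 0
  have := h1 1
  have := h1 2
  have := h1 3
  have := h1 4
  omega

theorem joinFamily_two : joinFamily 2 = joinSet (critFamily 1) (critFamily 1) := by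
  ext c
  constructor
  · rintro ⟨a, b, ha, hb, hab, hc⟩
    obtain ⟨rfl, rfl⟩ : a = 1 ∧ b = 1 := by omega
    exact hc
  · exact fun hc => ⟨1, 1, by omega, by omega, rfl, hc⟩

theorem critFamily_two : critFamily 2 = {(K 2).cls} := by
  rw [critFamily_eq le_rfl, buoyFamily_eq_empty le_rfl, Set.union_empty, joinFamily_two,
    critFamily_one, cls_K_succ 1]
  ext c
  constructor
  · rintro ⟨G, H, hG, hH, rfl⟩
    exact join_congr hG hH
  · rintro rfl
    exact ⟨_, _, rfl, rfl, rfl⟩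

/-- With `k + 1 ≤ 5` the smaller summand is 1 or 2. The only 2-critical graph is `K₂`, a join of two
single vertices, and by associativity one of them can be split off. -/
theorem joinFamily_eq {k : ℕ} (h2 : 2 ≤ k) (h5 : k ≤ 4) :
    joinFamily (k + 1) = joinSet (critFamily 1) (critFamily k) := by
  have key : ∀ a b, 0 < a → a ≤ b → a + b = k + 1 →
      joinSet (critFamily a) (critFamily b) ⊆ joinSet (critFamily 1) (critFamily k) := by
    rintro a b ha hle hab c ⟨G, H, hG, hH, rfl⟩
    obtain rfl | rfl : a = 1 ∨ a = 2 := by omega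
    · obtain rfl : b = k := by omega
      exact ⟨G, H, hG, hH, rfl⟩
    · rw [critFamily_two] at hG
      obtain rfl : k = 1 + b := by omega
      exact join_mem_joinSet_one one_pos (by omega) (Eq.trans hG (cls_K_succ 1))
        (critFamily_one.ge rfl) hH
  refine Set.Subset.antisymm ?_ fun c hc => ⟨1, k, one_pos, by omega, by omega, hc⟩
  rintro c ⟨a, b, ha, hb, hab, hc⟩
  rcases le_total a b with hle | hle
  · exact key a b ha hle hab hc
  · rw [joinSet_comm] at hc
    exact key b a hb hle (by omega) hc

theorem cls_C5 : C5.cls = (buoy fun _ => K 1).cls := by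
  have h : IsSubst C5.graph (cycleGraph 5) (id : Fin 5 → Fin 5) := fun _ _ _ => Iff.rfl
  rw [cls_eq_buoy h]
  refine buoy_congr fun i => cls_eq_K ?_ ?_
  · rintro ⟨x, hx⟩ ⟨y, hy⟩ hxy
    exact absurd (Subtype.ext (hx.trans hy.symm)) hxy
  · exact Nat.card_unique (α := ({i} : Set (Fin 5)))

theorem cls_T2 : T2.cls = (join (K 1) C5).cls := by
  let f : Fin 1 ⊕ Fin 5 → Fin 6 := Sum.elim (fun _ => 5) Fin.castSucc
  have hf : Function.Bijective f := by decide
  refine (cls_eq_iff.2 ⟨⟨Equiv.ofBijective f hf, ?_⟩⟩).symm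
  have h1 : ∀ x y : Fin 5, T2.graph.Adj x.castSucc y.castSucc ↔ C5.graph.Adj x y := by
    simp only [T2, C5, fromEdgeSet_adj, Set.mem_insert_iff, Set.mem_singleton_iff]
    decide
  have h2 : ∀ y : Fin 5, T2.graph.Adj (5 : Fin 6) y.castSucc := by
    simp only [T2, fromEdgeSet_adj, Set.mem_insert_iff, Set.mem_singleton_iff]
    decide
  rintro (x | x) (y | y)
  · refine iff_of_false (fun h => h.ne rfl) fun h => h.ne ?_
    exact congrArg Sum.inl (Subsingleton.elim (α := Fin 1) x y)
  · exact iff_of_true (h2 y) (join_adj_inl_inr _ _)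
  · exact iff_of_true (h2 x).symm (join_adj_inl_inr _ _).symm
  · exact (h1 x y).trans join_adj_inr.symm

theorem cls_T3 : T3.cls = (buoy ![K 1, K 2, K 1, K 2, K 1]).cls := by
  -- Vertices 5 and 6 are true twins of 0 and 2. The cycle is shifted by one so that the doubled
  -- bags get the indices 1 and 3.
  let π : Fin 7 → Fin 5 := ![1, 2, 3, 4, 0, 1, 3]
  have hadj : ∀ x y : Fin 7, T3.graph.Adj x y ↔
      x ≠ y ∧ (π x = π y ∨ (cycleGraph 5).Adj (π x) (π y)) := by
    simp only [T3, fromEdgeSet_adj, Set.mem_insert_iff, Set.mem_singleton_iff]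
    decide
  have h : IsSubst T3.graph (cycleGraph 5) π := by
    intro u v huv
    exact (hadj u v).trans ⟨fun h => h.2.resolve_left huv,
      fun h => ⟨fun e => huv (congrArg π e), Or.inr h⟩⟩
  have hcard : ∀ i, Nat.card (π ⁻¹' {i}) = ![1, 2, 1, 2, 1] i := by
    intro i
    refine (Nat.subtype_card (Finset.univ.filter fun x => π x = i) fun x => by simp).trans ?_
    revert i
    decide
  rw [cls_eq_buoy h]
  refine buoy_congr fun i => ?_
  have hK : (T3.sub (π ⁻¹' {i})).cls = (K (![1, 2, 1, 2, 1] i)).cls := by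
    refine cls_eq_K ?_ (hcard i)
    rintro ⟨x, hx⟩ ⟨y, hy⟩ hxy
    exact (hadj x y).2 ⟨fun e => hxy (Subtype.ext e), Or.inl (Eq.trans hx (Eq.symm hy))⟩
  rw [hK]
  fin_cases i <;> rfl

end FinGraph

/-! ### The families for `k ≤ 6` -/

namespace FinGraph

namespace BuoyTerm

/-- The clique on two vertices. -/
abbrev k2 : BuoyTerm := join pt pt

/-- The clique on three vertices. -/
abbrev k3 : BuoyTerm := join pt k2

/-- The cycle on five vertices. -/
abbrev c5 : BuoyTerm := buoy pt pt pt pt pt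

/-- The clique on four vertices. -/
abbrev t1 : BuoyTerm := join pt k3

/-- The wheel with five spokes. -/
abbrev t2 : BuoyTerm := join pt c5

/-- The 4-critical buoy. -/
abbrev t3 : BuoyTerm := buoy pt k2 pt k2 pt

/-- The 5-critical buoys. -/
abbrev buoys5 : List BuoyTerm :=
  [buoy k2 k2 k2 k2 pt, buoy k2 pt k3 pt k2, buoy k2 pt c5 pt k2, buoy pt k3 pt k3 pt,
    buoy pt k3 pt c5 pt, buoy pt c5 pt c5 pt]

/-- The 5-critical graphs. -/
abbrev crit5 : List BuoyTerm := [join pt t1, join pt t2, join pt t3] ++ buoys5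

/-- The 6-critical joins. -/
abbrev joins6 : List BuoyTerm := crit5.map (join pt) ++ [join c5 c5]

theorem toCls_pt : pt.toCls = (K 1).cls := rfl

theorem toCls_k2 : k2.toCls = (K 2).cls := (cls_K_succ 1).symm

theorem toCls_k3 : k3.toCls = (K 3).cls :=
  ((cls_K_succ 2).trans (join_congr rfl toCls_k2.symm)).symm

theorem toCls_c5 : c5.toCls = C5.cls := by
  rw [cls_C5]
  refine congrArg (fun B => (FinGraph.buoy B).cls) (funext fun i => ?_)
  fin_cases i <;> rfl

theorem toCls_t1 : t1.toCls = T1.cls :=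
  ((cls_K_succ 3).trans (join_congr rfl toCls_k3.symm)).symm

theorem toCls_t2 : t2.toCls = T2.cls := (cls_T2.trans (join_congr rfl toCls_c5.symm)).symm

theorem toCls_buoy {a b c d e : BuoyTerm} {A B C D E : FinGraph} (ha : a.toCls = A.cls)
    (hb : b.toCls = B.cls) (hc : c.toCls = C.cls) (hd : d.toCls = D.cls)
    (he : e.toCls = E.cls) : (buoy a b c d e).toCls = (FinGraph.buoy ![A, B, C, D, E]).cls := by
  refine buoy_congr fun i => ?_
  fin_cases i
  exacts [ha, hb, hc, hd, he]

theorem toCls_t3 : t3.toCls = T3.cls :=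
  (toCls_buoy toCls_pt toCls_k2 toCls_pt toCls_k2 toCls_pt).trans cls_T3.symm

theorem critFamily_one_eq : critFamily 1 = classes [pt] := by
  rw [critFamily_one, classes_cons, classes_nil, toCls_pt, insert_empty_eq]

theorem critFamily_two_eq : critFamily 2 = classes [k2] := by
  rw [critFamily_two, classes_cons, classes_nil, toCls_k2, insert_empty_eq]

theorem buoyFamily_three_eq : buoyFamily 3 = classes [c5] := by
  have h := buoysOfPattern_eq_classes critFamily_one_eq critFamily_one_eq critFamily_one_eq
    critFamily_one_eq critFamily_one_eq
  rw [buoyFamily_eq patternsAre_three]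
  simpa [buoyList] using h

theorem critFamily_three_eq : critFamily 3 = classes [k3, c5] := by
  rw [critFamily_eq (by norm_num), joinFamily_eq le_rfl (by norm_num), buoyFamily_three_eq,
    critFamily_one_eq, critFamily_two_eq, joinSet_classes, ← classes_append]
  rfl

theorem buoyFamily_four_eq : buoyFamily 4 = classes [t3] := by
  have h := buoysOfPattern_eq_classes critFamily_one_eq critFamily_two_eq critFamily_one_eq
    critFamily_two_eq critFamily_one_eq
  rw [buoyFamily_eq patternsAre_four]
  simpa [buoyList] using h

theorem joinFamily_four_eq : joinFamily 4 = classes [t1, t2] := by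
  rw [joinFamily_eq (by norm_num) (by norm_num), critFamily_one_eq, critFamily_three_eq,
    joinSet_classes]
  rfl

theorem critFamily_four_eq : critFamily 4 = classes [t1, t2, t3] := by
  rw [critFamily_eq (by norm_num), joinFamily_four_eq, buoyFamily_four_eq, ← classes_append]
  rfl

theorem buoysOfPattern_22221 :
    buoysOfPattern ![2, 2, 2, 2, 1] = classes [buoy k2 k2 k2 k2 pt] :=
  buoysOfPattern_eq_classes critFamily_two_eq critFamily_two_eq critFamily_two_eq
    critFamily_two_eq critFamily_one_eq

theorem buoysOfPattern_21312 :
    buoysOfPattern ![2, 1, 3, 1, 2] = classes [buoy k2 pt k3 pt k2, buoy k2 pt c5 pt k2] :=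
  buoysOfPattern_eq_classes critFamily_two_eq critFamily_one_eq critFamily_three_eq
    critFamily_one_eq critFamily_two_eq

/-- The pattern is a palindrome, so the two mixed choices of `k3` and `c5` are reflections of each
other. -/
theorem buoysOfPattern_13131 : buoysOfPattern ![1, 3, 1, 3, 1] =
    classes [buoy pt k3 pt k3 pt, buoy pt k3 pt c5 pt, buoy pt c5 pt c5 pt] := by
  have h : _ = classes [buoy pt k3 pt k3 pt, buoy pt k3 pt c5 pt, buoy pt c5 pt k3 pt,
      buoy pt c5 pt c5 pt] := buoysOfPattern_eq_classes critFamily_one_eq critFamily_three_eq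
    critFamily_one_eq critFamily_three_eq critFamily_one_eq
  rw [h]
  simp only [classes_cons, toCls_buoy_reverse pt c5 pt k3 pt, Set.insert_idem]

theorem buoyFamily_five_eq : buoyFamily 5 = classes buoys5 := by
  rw [buoyFamily_eq patternsAre_five]
  ext x
  simp only [List.mem_cons, List.not_mem_nil, or_false, exists_eq_or_imp, exists_eq_left,
    Set.mem_ofPred_eq, buoysOfPattern_22221, buoysOfPattern_21312, buoysOfPattern_13131,
    ← Set.mem_union, ← classes_append]
  rfl

theorem joinFamily_five_eq : joinFamily 5 = classes [join pt t1, join pt t2, join pt t3] := by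
  rw [joinFamily_eq (by norm_num) (by norm_num), critFamily_one_eq, critFamily_four_eq,
    joinSet_classes]
  rfl

theorem critFamily_five_eq : critFamily 5 = classes crit5 := by
  rw [critFamily_eq (by norm_num), joinFamily_five_eq, buoyFamily_five_eq, ← classes_append]

theorem buoysOfPattern_22223 : buoysOfPattern ![2, 2, 2, 2, 3] =
    classes [buoy k2 k2 k2 k2 k3, buoy k2 k2 k2 k2 c5] :=
  buoysOfPattern_eq_classes critFamily_two_eq critFamily_two_eq critFamily_two_eq
    critFamily_two_eq critFamily_three_eq

/-- No nontrivial symmetry of the cycle fixes this pattern, so both mixed choices are kept. -/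
theorem buoysOfPattern_23231 : buoysOfPattern ![2, 3, 2, 3, 1] =
    classes [buoy k2 k3 k2 k3 pt, buoy k2 k3 k2 c5 pt, buoy k2 c5 k2 k3 pt,
      buoy k2 c5 k2 c5 pt] :=
  buoysOfPattern_eq_classes critFamily_two_eq critFamily_three_eq critFamily_two_eq
    critFamily_three_eq critFamily_one_eq

theorem buoysOfPattern_23132 : buoysOfPattern ![2, 3, 1, 3, 2] =
    classes [buoy k2 k3 pt k3 k2, buoy k2 k3 pt c5 k2, buoy k2 c5 pt c5 k2] := by
  have h : _ = classes [buoy k2 k3 pt k3 k2, buoy k2 k3 pt c5 k2, buoy k2 c5 pt k3 k2,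
      buoy k2 c5 pt c5 k2] := buoysOfPattern_eq_classes critFamily_two_eq critFamily_three_eq
    critFamily_one_eq critFamily_three_eq critFamily_two_eq
  rw [h]
  simp only [classes_cons, toCls_buoy_reverse k2 c5 pt k3 k2, Set.insert_idem]

theorem buoysOfPattern_14132 : buoysOfPattern ![1, 4, 1, 3, 2] =
    classes [buoy pt t1 pt k3 k2, buoy pt t1 pt c5 k2, buoy pt t2 pt k3 k2,
      buoy pt t2 pt c5 k2, buoy pt t3 pt k3 k2, buoy pt t3 pt c5 k2] :=
  buoysOfPattern_eq_classes critFamily_one_eq critFamily_four_eq critFamily_one_eq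
    critFamily_three_eq critFamily_two_eq

/-- Reversal identifies the nine ordered choices for the two large bags with the six unordered
pairs, repetition allowed. -/
theorem buoysOfPattern_14141 : buoysOfPattern ![1, 4, 1, 4, 1] =
    classes [buoy pt t1 pt t1 pt, buoy pt t1 pt t2 pt, buoy pt t1 pt t3 pt,
      buoy pt t2 pt t2 pt, buoy pt t2 pt t3 pt, buoy pt t3 pt t3 pt] := by
  have h : _ = classes [buoy pt t1 pt t1 pt, buoy pt t1 pt t2 pt, buoy pt t1 pt t3 pt,
      buoy pt t2 pt t1 pt, buoy pt t2 pt t2 pt, buoy pt t2 pt t3 pt, buoy pt t3 pt t1 pt,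
      buoy pt t3 pt t2 pt, buoy pt t3 pt t3 pt] :=
    buoysOfPattern_eq_classes critFamily_one_eq critFamily_four_eq critFamily_one_eq
      critFamily_four_eq critFamily_one_eq
  rw [h]
  simp only [classes_cons, toCls_buoy_reverse pt t2 pt t1 pt, toCls_buoy_reverse pt t3 pt t1 pt,
    toCls_buoy_reverse pt t3 pt t2 pt]
  ext x
  simp only [Set.mem_insert_iff]
  tauto

/-- The 6-critical buoys. -/
abbrev buoys6 : List BuoyTerm :=
  [buoy k2 k2 k2 k2 k3, buoy k2 k2 k2 k2 c5] ++
  [buoy k2 k3 k2 k3 pt, buoy k2 k3 k2 c5 pt, buoy k2 c5 k2 k3 pt, buoy k2 c5 k2 c5 pt] ++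
  [buoy k2 k3 pt k3 k2, buoy k2 k3 pt c5 k2, buoy k2 c5 pt c5 k2] ++
  [buoy pt t1 pt k3 k2, buoy pt t1 pt c5 k2, buoy pt t2 pt k3 k2, buoy pt t2 pt c5 k2,
    buoy pt t3 pt k3 k2, buoy pt t3 pt c5 k2] ++
  [buoy pt t1 pt t1 pt, buoy pt t1 pt t2 pt, buoy pt t1 pt t3 pt, buoy pt t2 pt t2 pt,
    buoy pt t2 pt t3 pt, buoy pt t3 pt t3 pt]

theorem buoyFamily_six_eq_union : buoyFamily 6 =
    buoysOfPattern ![2, 2, 2, 2, 3] ∪ buoysOfPattern ![2, 3, 2, 3, 1] ∪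
      buoysOfPattern ![2, 3, 1, 3, 2] ∪ buoysOfPattern ![1, 4, 1, 3, 2] ∪
      buoysOfPattern ![1, 4, 1, 4, 1] := by
  rw [buoyFamily_eq patternsAre_six]
  ext x
  simp only [List.mem_cons, List.not_mem_nil, or_false, exists_eq_or_imp, exists_eq_left,
    Set.mem_ofPred_eq, Set.mem_union, or_assoc]

theorem buoyFamily_six_eq : buoyFamily 6 = classes buoys6 := by
  rw [buoyFamily_six_eq_union, buoysOfPattern_22223, buoysOfPattern_23231, buoysOfPattern_23132,
    buoysOfPattern_14132, buoysOfPattern_14141]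
  simp only [← classes_append]

/-- As in `joinFamily_eq`, a factor `K₂` or `K₃` yields a single vertex that can be split off. The
new case is 3 + 3 with both factors `C₅`. -/
theorem joinFamily_six : joinFamily 6 =
    joinSet (critFamily 1) (critFamily 5) ∪ joinSet (buoyFamily 3) (buoyFamily 3) := by
  have hb : buoyFamily 3 ⊆ critFamily 3 := by
    rw [critFamily_eq (by norm_num)]
    exact Set.subset_union_right
  have key : ∀ a b, 0 < a → a ≤ b → a + b = 6 → joinSet (critFamily a) (critFamily b) ⊆
      joinSet (critFamily 1) (critFamily 5) ∪ joinSet (buoyFamily 3) (buoyFamily 3) := by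
    rintro a b ha hle hab c ⟨G, H, hG, hH, rfl⟩
    obtain ⟨rfl, rfl⟩ | ⟨rfl, rfl⟩ | ⟨rfl, rfl⟩ :
        (a = 1 ∧ b = 5) ∨ (a = 2 ∧ b = 4) ∨ (a = 3 ∧ b = 3) := by omega
    · exact Or.inl ⟨G, H, hG, hH, rfl⟩
    · rw [critFamily_two] at hG
      exact Or.inl (join_mem_joinSet_one one_pos (by omega) (Eq.trans hG (cls_K_succ 1))
        (critFamily_one.ge rfl) hH)
    · have hK : (K 2).cls ∈ critFamily 2 := critFamily_two.ge rfl
      have hcase : ∀ G : FinGraph, G.cls ∈ critFamily 3 →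
          G.cls = (FinGraph.join (K 1) (K 2)).cls ∨ G.cls ∈ buoyFamily 3 := by
        intro G hG
        rw [critFamily_three_eq, classes_cons, toCls_k3, ← buoyFamily_three_eq] at hG
        exact hG.imp (fun h => Eq.trans h (cls_K_succ 2)) id
      rcases hcase G hG with h | h
      · exact Or.inl (join_mem_joinSet_one (by omega) (by omega) h hK hH)
      · rcases hcase H hH with h' | h'
        · rw [join_comm]
          exact Or.inl (join_mem_joinSet_one (by omega) (by omega) h' hK hG)
        · exact Or.inr ⟨G, H, h, h', rfl⟩
  refine Set.Subset.antisymm ?_ (Set.union_subset (fun c hc => ⟨1, 5, one_pos, by omega, rfl, hc⟩)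
    ?_)
  · rintro c ⟨a, b, ha, hb, hab, hc⟩
    rcases le_total a b with hle | hle
    · exact key a b ha hle hab hc
    · rw [joinSet_comm] at hc
      exact key b a hb hle (by omega) hc
  · rintro c ⟨G, H, hG, hH, rfl⟩
    exact ⟨3, 3, by omega, by omega, rfl, G, H, hb hG, hb hH, rfl⟩

theorem joinFamily_six_eq : joinFamily 6 = classes joins6 := by
  rw [joinFamily_six, critFamily_one_eq, critFamily_five_eq, buoyFamily_three_eq,
    joinSet_classes, joinSet_classes, ← classes_append]
  rfl

theorem critFamily_six_eq : critFamily 6 = classes (joins6 ++ buoys6) := by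
  rw [critFamily_eq (by norm_num), joinFamily_six_eq, buoyFamily_six_eq, ← classes_append]

theorem encard_classes_of {L : List BuoyTerm} {n : ℕ} (h : (L.map inv).Nodup)
    (hn : L.length = n) : (classes L).encard = n := by
  rw [encard_classes h, hn]

theorem toCls_F1 : (join pt t1).toCls = F1.cls := join_congr rfl toCls_t1

theorem toCls_F2 : (join pt t2).toCls = F2.cls := join_congr rfl toCls_t2

theorem toCls_F3 : (join pt t3).toCls = F3.cls := join_congr rfl toCls_t3

theorem toCls_F4 : (buoy k2 k2 k2 k2 pt).toCls = F4.cls :=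
  toCls_buoy toCls_k2 toCls_k2 toCls_k2 toCls_k2 toCls_pt

theorem toCls_F5 : (buoy k2 pt k3 pt k2).toCls = F5.cls :=
  toCls_buoy toCls_k2 toCls_pt toCls_k3 toCls_pt toCls_k2

theorem toCls_F6 : (buoy k2 pt c5 pt k2).toCls = F6.cls :=
  toCls_buoy toCls_k2 toCls_pt toCls_c5 toCls_pt toCls_k2

theorem toCls_F7 : (buoy pt k3 pt k3 pt).toCls = F7.cls :=
  toCls_buoy toCls_pt toCls_k3 toCls_pt toCls_k3 toCls_pt

theorem toCls_F8 : (buoy pt k3 pt c5 pt).toCls = F8.cls :=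
  toCls_buoy toCls_pt toCls_k3 toCls_pt toCls_c5 toCls_pt

theorem toCls_F9 : (buoy pt c5 pt c5 pt).toCls = F9.cls :=
  toCls_buoy toCls_pt toCls_c5 toCls_pt toCls_c5 toCls_pt

end BuoyTerm

end FinGraph

open FinGraph FinGraph.BuoyTerm in
theorem mainTheorem3 :
    -- `k = 1, 2, 3`
    (FinGraph.critFamily 1 = {(FinGraph.K 1).cls} ∧
      FinGraph.critFamily 2 = {(FinGraph.K 2).cls} ∧
      FinGraph.critFamily 3 = {(FinGraph.K 3).cls, FinGraph.C5.cls} ∧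
      (FinGraph.critFamily 3).encard = 2 ∧
      FinGraph.buoyFamily 1 = ∅ ∧ FinGraph.buoyFamily 2 = ∅ ∧
      FinGraph.buoyFamily 3 = {FinGraph.C5.cls}) ∧
    -- `k = 4`
    (FinGraph.critFamily 4 = FinGraph.joinFamily 4 ∪ FinGraph.buoyFamily 4 ∧
      FinGraph.PatternsAre 4 [![1, 2, 1, 2, 1]] ∧
      FinGraph.buoyFamily 4 = {FinGraph.T3.cls} ∧
      FinGraph.joinFamily 4 =
        FinGraph.joinSet (FinGraph.critFamily 1) (FinGraph.critFamily 3) ∧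
      FinGraph.joinFamily 4 = {FinGraph.T1.cls, FinGraph.T2.cls} ∧
      FinGraph.critFamily 4 = {FinGraph.T1.cls, FinGraph.T2.cls, FinGraph.T3.cls} ∧
      (FinGraph.critFamily 4).encard = 3) ∧
    -- `k = 5`
    (FinGraph.critFamily 5 = FinGraph.joinFamily 5 ∪ FinGraph.buoyFamily 5 ∧
      FinGraph.PatternsAre 5 [![2, 2, 2, 2, 1], ![2, 1, 3, 1, 2], ![1, 3, 1, 3, 1]] ∧
      FinGraph.buoysOfPattern ![2, 2, 2, 2, 1] = {FinGraph.F4.cls} ∧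
      FinGraph.buoysOfPattern ![2, 1, 3, 1, 2] = {FinGraph.F5.cls, FinGraph.F6.cls} ∧
      FinGraph.buoysOfPattern ![1, 3, 1, 3, 1] =
        {FinGraph.F7.cls, FinGraph.F8.cls, FinGraph.F9.cls} ∧
      (FinGraph.buoyFamily 5).encard = 6 ∧
      FinGraph.joinFamily 5 =
        FinGraph.joinSet (FinGraph.critFamily 1) (FinGraph.critFamily 4) ∧
      FinGraph.joinFamily 5 = {FinGraph.F1.cls, FinGraph.F2.cls, FinGraph.F3.cls} ∧
      FinGraph.critFamily 5 =
        {FinGraph.F1.cls, FinGraph.F2.cls, FinGraph.F3.cls, FinGraph.F4.cls, FinGraph.F5.cls,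
          FinGraph.F6.cls, FinGraph.F7.cls, FinGraph.F8.cls, FinGraph.F9.cls} ∧
      (FinGraph.critFamily 5).encard = 9) ∧
    -- `k = 6`
    (FinGraph.critFamily 6 = FinGraph.joinFamily 6 ∪ FinGraph.buoyFamily 6 ∧
      FinGraph.PatternsAre 6 [![2, 2, 2, 2, 3], ![2, 3, 2, 3, 1], ![2, 3, 1, 3, 2],
        ![1, 4, 1, 3, 2], ![1, 4, 1, 4, 1]] ∧
      FinGraph.buoyFamily 6 =
        FinGraph.buoysOfPattern ![2, 2, 2, 2, 3] ∪ FinGraph.buoysOfPattern ![2, 3, 2, 3, 1] ∪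
          FinGraph.buoysOfPattern ![2, 3, 1, 3, 2] ∪ FinGraph.buoysOfPattern ![1, 4, 1, 3, 2] ∪
          FinGraph.buoysOfPattern ![1, 4, 1, 4, 1] ∧
      (FinGraph.buoysOfPattern ![2, 2, 2, 2, 3]).encard = 2 ∧
      (FinGraph.buoysOfPattern ![2, 3, 2, 3, 1]).encard = 4 ∧
      (FinGraph.buoysOfPattern ![2, 3, 1, 3, 2]).encard = 3 ∧
      (FinGraph.buoysOfPattern ![1, 4, 1, 3, 2]).encard = 6 ∧
      (FinGraph.buoysOfPattern ![1, 4, 1, 4, 1]).encard = 6 ∧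
      (FinGraph.buoyFamily 6).encard = 21 ∧
      FinGraph.joinFamily 6 =
        FinGraph.joinSet (FinGraph.critFamily 1) (FinGraph.critFamily 5) ∪
          FinGraph.joinSet (FinGraph.buoyFamily 3) (FinGraph.buoyFamily 3) ∧
      (FinGraph.joinFamily 6).encard = 10 ∧
      (FinGraph.critFamily 6).encard = 31) := by
  refine ⟨⟨critFamily_one, critFamily_two, ?_, ?_, buoyFamily_eq_empty (by norm_num),
      buoyFamily_eq_empty le_rfl, ?_⟩,
    ⟨critFamily_eq (by norm_num), patternsAre_four, ?_, joinFamily_eq (by norm_num) (by norm_num),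
      ?_, ?_, ?_⟩,
    ⟨critFamily_eq (by norm_num), patternsAre_five, ?_, ?_, ?_, ?_,
      joinFamily_eq (by norm_num) (by norm_num), ?_, ?_, ?_⟩,
    ⟨critFamily_eq (by norm_num), patternsAre_six, buoyFamily_six_eq_union, ?_, ?_, ?_, ?_, ?_,
      ?_, joinFamily_six, ?_, ?_⟩⟩
  · simp only [critFamily_three_eq, classes_cons, classes_nil, toCls_k3, toCls_c5,
      insert_empty_eq]
  -- Here and in the counts below, `decide` checks that the triples `inv` of the listed terms are
  -- pairwise distinct.
  · exact critFamily_three_eq ▸ encard_classes_of (by decide) rfl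
  · simp only [buoyFamily_three_eq, classes_cons, classes_nil, toCls_c5, insert_empty_eq]
  · simp only [buoyFamily_four_eq, classes_cons, classes_nil, toCls_t3, insert_empty_eq]
  · simp only [joinFamily_four_eq, classes_cons, classes_nil, toCls_t1, toCls_t2,
      insert_empty_eq]
  · simp only [critFamily_four_eq, classes_cons, classes_nil, toCls_t1, toCls_t2, toCls_t3,
      insert_empty_eq]
  · exact critFamily_four_eq ▸ encard_classes_of (by decide) rfl
  · simp only [buoysOfPattern_22221, classes_cons, classes_nil, toCls_F4, insert_empty_eq]
  · simp only [buoysOfPattern_21312, classes_cons, classes_nil, toCls_F5, toCls_F6,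
      insert_empty_eq]
  · simp only [buoysOfPattern_13131, classes_cons, classes_nil, toCls_F7, toCls_F8, toCls_F9,
      insert_empty_eq]
  · exact buoyFamily_five_eq ▸ encard_classes_of (by decide) rfl
  · simp only [joinFamily_five_eq, classes_cons, classes_nil, toCls_F1, toCls_F2, toCls_F3,
      insert_empty_eq]
  · simp only [critFamily_five_eq, List.cons_append, List.nil_append, classes_cons, classes_nil,
      toCls_F1, toCls_F2, toCls_F3, toCls_F4, toCls_F5, toCls_F6, toCls_F7, toCls_F8, toCls_F9,
      insert_empty_eq]
  · exact critFamily_five_eq ▸ encard_classes_of (by decide) rfl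
  · exact buoysOfPattern_22223 ▸ encard_classes_of (by decide) rfl
  · exact buoysOfPattern_23231 ▸ encard_classes_of (by decide) rfl
  · exact buoysOfPattern_23132 ▸ encard_classes_of (by decide) rfl
  · exact buoysOfPattern_14132 ▸ encard_classes_of (by decide) rfl
  · exact buoysOfPattern_14141 ▸ encard_classes_of (by decide) rfl
  · exact buoyFamily_six_eq ▸ encard_classes_of (by decide) rfl
  · exact joinFamily_six_eq ▸ encard_classes_of (by decide) rfl
  · exact critFamily_six_eq ▸ encard_classes_of (by decide) rfl
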